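/- Let $d\ge 2$ and let $\zeta$ be a substitution on $\mathcal A=\{0,\dots,d-1\}$, i.e. a map assigning to each letter $b$ a non-empty finite word $\zeta(b)=u^b_1\cdots u^b_{|\zeta(b)|}$ over $\mathcal A$. Let $S_\zeta\in M_d(\mathbb Z)$ be its substitution matrix, whose $(i,j)$ entry is the number of occurrences of $i$ in $\zeta(j)$. For $\xi\in\mathbb R^d$ let $\mathscr M_\zeta(\xi)\in M_d(\mathbb C)$ be the matrix with entries $$\mathscr M_\zeta(\xi)_{b,c}=\sum_{1\le j\le|\zeta(b)|,\ u^b_j=c}\exp\Big(-2\pi i\sum_{k=1}^{j-1}\xi_{u^b_k}\Big),$$ and for $n\ge1$ let $\mathscr M_\zeta(\xi,n)=\mathscr M_\zeta((S_\zeta^t)^{n-1}\xi)\cdots\mathscr M_\zeta(S_\zeta^t\xi)\,\mathscr M_\zeta(\xi)$. Let $\|\cdot\|$ be the Frobenius norm, with the convention $\log 0=-\infty$. Let $v\in\mathbb R^d\setminus\{0\}$ and let $V=\mathrm{Span}_{\mathbb R}W$ be its minimal subspace, where $W\subseteq\mathbb Q^d$ is the smallest $S_\zeta^t$-invariant rational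 subspace with $v\in\mathrm{Span}_{\mathbb R}W$. Put $r=\dim V$. A lattice basis of $V$ is a basis of $V$ consisting of integer vectors, with respect to which every integer vector of $V$ has integer coordinates. A sequence in $V$ is u.d. mod $1$ in $V$ if its sequence of coordinate vectors with respect to a (equivalently, any) lattice basis of $V$ is uniformly distributed mod $1$ in $\mathbb R^r$. Suppose that $S_\zeta^t|_V$ is non-singular and that none of its (complex) eigenvalues is a root of unity. Let $w\in V$ be such that $((S_\zeta^t)^{kn}w)_{n\ge0}$ is u.d. mod $1$ in $V$ for every $k\ge1$. Then $$\chi_\zeta^+(w):=\limsup_{n\to\infty}\frac1n\log\|\mathscr M_\zeta(w,n)\|\ \le\ \chi(\mathscr M_\zeta,v).$$ Here $\chi(\mathscr M_\zeta,v)$ is the essential Lyapunov exponent of $v$: the real number (which exists, and is the same for all lattice bases $\mathcal B=(b_1,\dots,b_r)$ of $V$; such bases exist) such that $$\lim_{n\to\infty}\frac1n\log\|\widetilde{\mathscr M}_\zeta(s,n)\|=\chi(\mathscr M_\zeta,v)\quad\text{for a.e. } s\in\mathbb T^r=\mathbb R^r/\mathbb Z^r$$ with respect to normalized Haar measure, where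 $\widetilde{\mathscr M}_\zeta(s)=\mathscr M_\zeta(s_1b_1+\cdots+s_rb_r)$ and $\widetilde{\mathscr M}_\zeta(s,n)=\widetilde{\mathscr M}_\zeta(B^{n-1}s)\cdots\widetilde{\mathscr M}_\zeta(Bs)\,\widetilde{\mathscr M}_\zeta(s)$, with $B$ the integer matrix of $S_\zeta^t|_V$ in the basis $\mathcal B$ (these functions are $\mathbb Z^r$-periodic in $s$). -/

import Mathlib

open Filter Topology MeasureTheory

namespace SpectralCocycle

/-! ### Integer matrices and minimal subspaces -/

/-- The linear map `x ↦ A x` on `ℝ^d` given by an integer matrix `A`. -/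
noncomputable def realMap {d : ℕ} (A : Matrix (Fin d) (Fin d) ℤ) :
    (Fin d → ℝ) →ₗ[ℝ] (Fin d → ℝ) :=
  Matrix.toLin' (A.map (fun m : ℤ => (m : ℝ)))

/-- The linear map `x ↦ A x` on `ℚ^d` given by an integer matrix `A`. -/
noncomputable def ratMap {d : ℕ} (A : Matrix (Fin d) (Fin d) ℤ) :
    (Fin d → ℚ) →ₗ[ℚ] (Fin d → ℚ) :=
  Matrix.toLin' (A.map (fun m : ℤ => (m : ℚ)))

/-- The real span, inside `ℝ^d`, of a rational subspace `W` of `ℚ^d`. -/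
def realSpan {d : ℕ} (W : Submodule ℚ (Fin d → ℚ)) : Submodule ℝ (Fin d → ℝ) :=
  Submodule.span ℝ ((fun (q : Fin d → ℚ) (i : Fin d) => (q i : ℝ)) '' (W : Set (Fin d → ℚ)))

/-- The `A`-invariant rational subspaces `W` of `ℚ^d` whose real span contains `v`. -/
def admissible {d : ℕ} (A : Matrix (Fin d) (Fin d) ℤ) (v : Fin d → ℝ) :
    Set (Submodule ℚ (Fin d → ℚ)) :=
  {W | (∀ q ∈ W, ratMap A q ∈ W) ∧ v ∈ realSpan W}

/-- The minimal subspace of `v` with respect to `A`: the real span of the smallest admissible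
rational subspace, which is the intersection of all of them (`isLeast_sInf_admissible`). -/
def minimalSubspace {d : ℕ} (A : Matrix (Fin d) (Fin d) ℤ) (v : Fin d → ℝ) :
    Submodule ℝ (Fin d → ℝ) :=
  realSpan (sInf (admissible A v))

/-- Membership in the real span, tested with the `ℚ`-linear functionals on `ℝ`. -/
theorem mem_realSpan_iff {d : ℕ} (W : Submodule ℚ (Fin d → ℚ)) (x : Fin d → ℝ) :
    x ∈ realSpan W ↔ ∀ h : ℝ →ₗ[ℚ] ℚ, (fun i => h (x i)) ∈ W := by
  constructor
  · intro hx h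
    unfold realSpan at hx
    induction hx using Submodule.span_induction generalizing h with
    | mem y hy =>
      obtain ⟨q, hq, rfl⟩ := hy
      convert W.smul_mem (h 1) hq using 1
      funext i
      have := h.map_smul (q i) 1
      rw [Rat.smul_def, mul_one] at this
      simp [this, mul_comm]
    | zero =>
      convert W.zero_mem using 1
      funext i
      simp
    | add y z _ _ hy hz => simpa [Pi.add_def] using W.add_mem (hy h) (hz h)
    | smul c y _ hy =>
      have := hy (h ∘ₗ (LinearMap.mulLeft ℚ c))
      simpa using this
  · intro H
    let b := Module.Basis.ofVectorSpace ℚ ℝ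
    classical
    let S : Finset _ := Finset.univ.biUnion fun i => (b.repr (x i)).support
    have : x = ∑ j ∈ S, b j • (fun (i : Fin d) => ((b.coord j (x i) : ℚ) : ℝ)) := by
      funext i
      simp only [Finset.sum_apply, Pi.smul_apply, smul_eq_mul]
      conv_lhs => rw [← b.linearCombination_repr (x i)]
      rw [Finsupp.linearCombination_apply, Finsupp.sum_of_support_subset _ (s := S)]
      · exact Finset.sum_congr rfl fun j _ => by simp [Rat.smul_def, mul_comm]
      · exact Finset.subset_biUnion_of_mem (fun i => (b.repr (x i)).support) (Finset.mem_univ i)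
      · simp
    rw [this]
    refine Submodule.sum_mem _ fun j _ => Submodule.smul_mem _ _
      (Submodule.subset_span ⟨_, H (b.coord j), rfl⟩)

/-- The intersection of all admissible subspaces is the smallest admissible subspace. -/
theorem isLeast_sInf_admissible {d : ℕ} (A : Matrix (Fin d) (Fin d) ℤ) (v : Fin d → ℝ) :
    IsLeast (admissible A v) (sInf (admissible A v)) := by
  refine ⟨⟨?_, ?_⟩, fun W hW => sInf_le hW⟩
  · intro q hq
    simp only [Submodule.mem_sInf] at hq ⊢
    exact fun W hW => hW.1 q (hq W hW)
  · rw [mem_realSpan_iff]; intro h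
    simp only [Submodule.mem_sInf]
    exact fun W hW => (mem_realSpan_iff W v).1 hW.2 h

theorem realMap_mem_minimalSubspace {d : ℕ} (A : Matrix (Fin d) (Fin d) ℤ) (v : Fin d → ℝ) :
    ∀ x ∈ minimalSubspace A v, realMap A x ∈ minimalSubspace A v := by
  intro x hx
  unfold minimalSubspace realSpan at hx ⊢
  induction hx using Submodule.span_induction with
  | mem y hy =>
    obtain ⟨q, hq, rfl⟩ := hy
    refine Submodule.subset_span ⟨ratMap A q, ?_, ?_⟩
    · simp only [SetLike.mem_coe, Submodule.mem_sInf] at hq ⊢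
      exact fun W hW => hW.1 q (hq W hW)
    · funext i
      simp [ratMap, realMap, Matrix.mulVec, dotProduct]
  | zero => simp
  | add y z _ _ hy hz => rw [map_add]; exact Submodule.add_mem _ hy hz
  | smul c y _ hy => rw [map_smul]; exact Submodule.smul_mem _ c hy

/-- The restriction `A|_V` of `A` to the minimal subspace `V` of `v`. -/
noncomputable def restrictedMap {d : ℕ} (A : Matrix (Fin d) (Fin d) ℤ) (v : Fin d → ℝ) :
    minimalSubspace A v →ₗ[ℝ] minimalSubspace A v :=
  (realMap A).restrict (realMap_mem_minimalSubspace A v)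

/-- No complex eigenvalue of the real endomorphism `f` is a root of unity. -/
def NoRootOfUnityEigenvalue {V : Type*} [AddCommGroup V] [Module ℝ V] [Module.Finite ℝ V]
    (f : V →ₗ[ℝ] V) : Prop :=
  ∀ z : ℂ, (f.charpoly.map (algebraMap ℝ ℂ)).IsRoot z → ∀ m : ℕ, 1 ≤ m → z ^ m ≠ 1

/-! ### Lattice bases and uniform distribution -/

/-- A vector of `ℝ^d` with integer entries. -/
def IsIntegerVector {d : ℕ} (x : Fin d → ℝ) : Prop := ∀ i, ∃ m : ℤ, x i = m

/-- A lattice basis of `V`: a basis of integer vectors with respect to which every integer vector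
of `V` has integer coordinates. -/
def IsLatticeBasis {d r : ℕ} {V : Submodule ℝ (Fin d → ℝ)} (b : Module.Basis (Fin r) ℝ V) : Prop :=
  (∀ i, IsIntegerVector (b i : Fin d → ℝ)) ∧
    ∀ x : V, IsIntegerVector (x : Fin d → ℝ) → IsIntegerVector (b.equivFun x)

/-- Uniform distribution modulo `1` of a sequence in `ℝ^r`. -/
def UDModOne {r : ℕ} (x : ℕ → Fin r → ℝ) : Prop :=
  ∀ a c : Fin r → ℝ, (∀ i, 0 ≤ a i ∧ a i ≤ c i ∧ c i ≤ 1) →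
    Tendsto
      (fun N : ℕ =>
        (Set.ncard {n : ℕ | n < N ∧ ∀ i, Int.fract (x n i) ∈ Set.Ico (a i) (c i)} : ℝ) / N)
      atTop (𝓝 (∏ i, (c i - a i)))

/-- Uniform distribution modulo `1` in `V`: the coordinate vectors with respect to a lattice basis
are uniformly distributed modulo `1` (this does not depend on the lattice basis). -/
def UDModOneIn {d : ℕ} {V : Submodule ℝ (Fin d → ℝ)} (x : ℕ → V) : Prop :=
  ∃ b : Module.Basis (Fin (Module.finrank ℝ V)) ℝ V,
    IsLatticeBasis b ∧ UDModOne (fun n => b.equivFun (x n))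

/-! ### Substitutions and spectral cocycles -/

/-- A substitution on the alphabet `{0, …, d - 1}`: each letter is mapped to a non-empty word. -/
structure Substitution (d : ℕ) where
  word : Fin d → List (Fin d)
  word_ne_nil : ∀ a, word a ≠ []

/-- The substitution matrix: the entry `(i, j)` counts the occurrences of `i` in `ζ(j)`. -/
def Substitution.matrix {d : ℕ} (ζ : Substitution d) : Matrix (Fin d) (Fin d) ℤ :=
  Matrix.of fun i j => ((ζ.word j).count i : ℤ)

/-- The matrix function `𝓜_ζ` on `ℝ^d`: its entry `(b, c)` is the sum, over the positions `j` at
which the letter `c` occurs in `ζ(b) = u_0 u_1 ⋯`, of `exp(-2πi (ξ_{u_0} + ⋯ + ξ_{u_{j-1}}))`. -/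
noncomputable def Substitution.spectralMatrix {d : ℕ} (ζ : Substitution d) (ξ : Fin d → ℝ) :
    Matrix (Fin d) (Fin d) ℂ :=
  Matrix.of fun b c => ∑ j : Fin (ζ.word b).length,
    if (ζ.word b).get j = c then
      Complex.exp (-2 * Real.pi * Complex.I * ((((ζ.word b).take j).map ξ).sum : ℝ))
    else 0

/-- The product `M(T^{n-1} x) ⋯ M(T x) M(x)`. -/
def cocycle {X : Type*} {d : ℕ} (M : X → Matrix (Fin d) (Fin d) ℂ) (T : X → X) :
    ℕ → X → Matrix (Fin d) (Fin d) ℂ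
  | 0, _ => 1
  | n + 1, x => M (T^[n] x) * cocycle M T n x

/-- The spectral cocycle `𝓜_ζ(ξ, n)`. As `𝓜_ζ` is `ℤ^d`-periodic, the toral endomorphism induced by
the integer matrix `S_ζ^t` may be replaced by its lift to `ℝ^d`. -/
noncomputable def Substitution.spectralCocycle {d : ℕ} (ζ : Substitution d) (n : ℕ)
    (ξ : Fin d → ℝ) : Matrix (Fin d) (Fin d) ℂ :=
  cocycle ζ.spectralMatrix (realMap ζ.matrix.transpose) n ξ

/-- The minimal subspace of `v` with respect to the transposed substitution matrix. -/
abbrev Substitution.minSubspace {d : ℕ} (ζ : Substitution d) (v : Fin d → ℝ) :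
    Submodule ℝ (Fin d → ℝ) :=
  minimalSubspace ζ.matrix.transpose v

/-- The essential spectral cocycle of `v` in a basis `b` of its minimal subspace `V`: the product
`M(B^{n-1} s) ⋯ M(s)`, where `M(s) = 𝓜_ζ(∑ i, s_i b_i)` and `B` is the matrix of `S_ζ^t|_V` in the
basis `b`. When `b` is a lattice basis, it is `ℤ^r`-periodic in `s ∈ ℝ^r`. -/
noncomputable def Substitution.essentialCocycle {d r : ℕ} (ζ : Substitution d) (v : Fin d → ℝ)
    (b : Module.Basis (Fin r) ℝ (ζ.minSubspace v)) (n : ℕ) (s : Fin r → ℝ) :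
    Matrix (Fin d) (Fin d) ℂ :=
  cocycle (fun t : Fin r → ℝ => ζ.spectralMatrix (b.equivFun.symm t : Fin d → ℝ))
    (LinearMap.toMatrix b b (restrictedMap ζ.matrix.transpose v)).mulVec n s

section Norm

attribute [local instance] Matrix.frobeniusNormedAddCommGroup

/-- The logarithm of the Frobenius norm, with `log 0 = -∞`. -/
noncomputable def logNorm {d : ℕ} (M : Matrix (Fin d) (Fin d) ℂ) : EReal :=
  ENNReal.log ‖M‖ₑ

end Norm

/-- The pointwise upper Lyapunov exponent `χ_ζ^+(ξ)` of the spectral cocycle. -/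
noncomputable def Substitution.upperLyapunovExponent {d : ℕ} (ζ : Substitution d)
    (ξ : Fin d → ℝ) : EReal :=
  limsup (fun n : ℕ => logNorm (ζ.spectralCocycle n ξ) / (n : EReal)) atTop

/-- The representative in `[0,1)^r` of a point of the torus `(ℝ/ℤ)^r`. -/
noncomputable def torusRep {r : ℕ} (s : UnitAddTorus (Fin r)) : Fin r → ℝ :=
  fun i => (AddCircle.equivIco 1 0 (s i) : ℝ)

/-- The normalized Haar measure of the torus `(ℝ/ℤ)^r`. -/
noncomputable def torusHaar (r : ℕ) : Measure (UnitAddTorus (Fin r)) :=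
  Measure.pi fun _ => AddCircle.haarAddCircle

/-- `χ` is the essential Lyapunov exponent of `v`: lattice bases of the minimal subspace exist, and
for each of them the exponential growth rate of the norm of the essential spectral cocycle exists
and equals `χ` at almost every point of the torus, with respect to the normalized Haar measure. -/
def Substitution.IsEssentialLyapunovExponent {d : ℕ} (ζ : Substitution d) (v : Fin d → ℝ)
    (χ : ℝ) : Prop :=
  (∃ b : Module.Basis (Fin (Module.finrank ℝ (ζ.minSubspace v))) ℝ (ζ.minSubspace v),
    IsLatticeBasis b) ∧
  ∀ b : Module.Basis (Fin (Module.finrank ℝ (ζ.minSubspace v))) ℝ (ζ.minSubspace v),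
    IsLatticeBasis b →
      ∀ᵐ s ∂(torusHaar (Module.finrank ℝ (ζ.minSubspace v))),
        Tendsto (fun n : ℕ => logNorm (ζ.essentialCocycle v b n (torusRep s)) / (n : EReal))
          atTop (𝓝 (χ : EReal))

end SpectralCocycle

open SpectralCocycle

/-! The spectral matrix, restricted to the minimal subspace and written in the coordinates of a
lattice basis, is a matrix of trigonometric polynomials with integer coefficients on a torus, and
the matrix `B` of the restricted map acts on this torus by an endomorphism. Since `B` is nonsingular
and no power of it has the eigenvalue `1`, no nonzero frequency has a finite orbit under the
transpose of `B`, so the endomorphism is ergodic (`ergodic_torusEnd`).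

Let `g n = log (max ‖M n‖ (exp (-n)))` be the logarithm of the norm of the cocycle, floored at `-n`
(`flooredLog`). The floor keeps the sequence subadditive and makes its terms bounded continuous
functions. Let `χ` be the limit of `(∫ g n) / n`. The covering argument
`le_covering_of_subadditive` gives `liminf g n / n ≥ χ` almost everywhere. Up to a bounded error,
`g n` is dominated by the Birkhoff sums of `g k / k`, for each `k` (`mul_le_sum_of_subadditive`), so
`limsup g n / n ≤ χ` at every point whose orbit averages of each `g k` are at most `∫ g k` in the
limit. Almost every point is of this kind by Birkhoff's theorem, and so is the given one, since its
orbit is uniformly distributed and `g k` is continuous (`UDModOne.eventually_sum_le`).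

It remains to see that the floor is harmless, for which `χ ≥ 0` suffices. Each `M n` has an entry
which is a nonzero trigonometric polynomial with integer coefficients, and such a polynomial has
nonnegative logarithmic Mahler measure (`integral_log_max_nonneg_of_mem_integralTrigPoly`): on the
cosets of a generic one-parameter subgroup it is a polynomial in one variable whose leading
coefficient has modulus at least `1`. Finally, any two lattice bases differ by an automorphism of
the torus, which preserves Haar measure, so `χ` does not depend on the basis. -/

namespace SpectralCocycle

/-! ### Bounded subadditive sequences over a measure preserving map -/

section Subadditive

variable {X : Type*} {T : X → X} {g : ℕ → X → ℝ} {C : ℝ}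

/-- The induction behind `mul_le_sum_of_subadditive`: writing `G i = g (m + k - i) (T^[i] x)` for
the value on the orbit segment from time `i` to time `m + k`, subadditivity gives
`G i ≤ g k (T^[i] x) + G (i + k)`, and the sum of these inequalities over `i < m` telescopes. -/
theorem sum_shift_le_of_subadditive
    (hbd : ∀ n x, |g n x| ≤ C * (n + 1))
    (hsub : ∀ m n x, g (m + n) x ≤ g m x + g n (T^[m] x)) (k m : ℕ) (x : X) :
    ∑ i ∈ Finset.range k, g (m + k - i) (T^[i] x) ≤
      ∑ j ∈ Finset.range m, g k (T^[j] x) + k * (C * (k + 1)) := by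
  have hC : 0 ≤ C := by simpa using (abs_nonneg _).trans (hbd 0 x)
  induction m generalizing x with
  | zero =>
    simp only [Finset.range_zero, Finset.sum_empty, zero_add]
    have : ∀ i ∈ Finset.range k, g (k - i) (T^[i] x) ≤ C * (k + 1) := by
      intro i _
      refine (le_abs_self _).trans ((hbd _ _).trans ?_)
      have : ((k - i : ℕ) : ℝ) ≤ k := by exact_mod_cast Nat.sub_le k i
      gcongr
    simpa using Finset.sum_le_sum this
  | succ m ih =>
    have h1 := Finset.sum_range_succ (fun i => g (m + 1 + k - i) (T^[i] x)) k
    have h2 := Finset.sum_range_succ' (fun i => g (m + 1 + k - i) (T^[i] x)) k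
    have h3 := ih (T x)
    have h4 := hsub k (m + 1) x
    have h5 := Finset.sum_range_succ' (fun j => g k (T^[j] x)) m
    have h6 : ∀ i, g (m + k - i) (T^[i] (T x)) = g (m + 1 + k - (i + 1)) (T^[i + 1] x) := by
      intro i
      rw [Function.iterate_succ_apply]
      congr 1; omega
    simp only [h6] at h3
    simp only [← Function.iterate_succ_apply, Nat.succ_eq_add_one] at h3
    simp only [Nat.sub_zero, Nat.add_sub_cancel, Function.iterate_zero, id] at h1 h2 h5
    rw [add_comm k (m + 1)] at h4
    linarith

/-- A subadditive sequence is dominated, up to a bounded error, by the Birkhoff sums of any of its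
terms: average over `i < k` the inequality obtained by cutting an orbit segment at the times
`i, i + k, i + 2k, …`. -/
theorem mul_le_sum_of_subadditive
    (hbd : ∀ n x, |g n x| ≤ C * (n + 1))
    (hsub : ∀ m n x, g (m + n) x ≤ g m x + g n (T^[m] x)) (k n : ℕ) (hkn : k ≤ n) (x : X) :
    k * g n x ≤ ∑ j ∈ Finset.range n, g k (T^[j] x) + 3 * (k * (C * (k + 1))) := by
  have hC : 0 ≤ C := by simpa using (abs_nonneg _).trans (hbd 0 x)
  obtain ⟨m, rfl⟩ := Nat.exists_eq_add_of_le' hkn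
  have h1 := sum_shift_le_of_subadditive hbd hsub k m x
  have h2 : ∑ i ∈ Finset.range k, g (m + k) x ≤
      ∑ i ∈ Finset.range k, (C * (k + 1) + g (m + k - i) (T^[i] x)) := by
    refine Finset.sum_le_sum fun i hi => ?_
    have hi := Finset.mem_range.1 hi
    have h := hsub i (m + k - i) x
    rw [show i + (m + k - i) = m + k by omega] at h
    have h' : g i x ≤ C * (k + 1) := by
      refine (le_abs_self _).trans ((hbd _ _).trans ?_)
      have : (i : ℝ) ≤ k := by exact_mod_cast hi.le
      gcongr
    linarith
  rw [Finset.sum_const, Finset.sum_add_distrib, Finset.sum_const, Finset.card_range,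
    nsmul_eq_mul, nsmul_eq_mul] at h2
  have h3 : ∑ j ∈ Finset.range k, -(C * (k + 1)) ≤
      ∑ j ∈ Finset.range k, g k (T^[m + j] x) :=
    Finset.sum_le_sum fun j _ => neg_le_of_abs_le (hbd _ _)
  rw [Finset.sum_const, Finset.card_range, nsmul_eq_mul] at h3
  rw [Finset.sum_range_add]
  linarith

/-- The covering estimate behind Kingman's theorem: an orbit segment is cut greedily into pieces
of length `n ≤ N` on which `g n < q n`, and single steps at the remaining points. -/
theorem le_covering_of_subadditive
    (hbd : ∀ n x, |g n x| ≤ C * (n + 1))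
    (hsub : ∀ m n x, g (m + n) x ≤ g m x + g n (T^[m] x)) (q : ℝ) (N : ℕ) (G : Set X)
    (hG : ∀ x ∈ G, ∃ n, 1 ≤ n ∧ n ≤ N ∧ g n x < q * n) (L : ℕ) (x : X) :
    g L x ≤ q * L + (2 * C + |q|) * ∑ j ∈ Finset.range L, Gᶜ.indicator 1 (T^[j] x)
      + (C + |q|) * (N + 1) := by
  have hC : 0 ≤ C := by simpa using (abs_nonneg _).trans (hbd 0 x)
  have hq := abs_nonneg q
  have hq1 := neg_abs_le q
  have hK : 0 ≤ 2 * C + |q| := by positivity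
  have hind : ∀ y, (0 : ℝ) ≤ Gᶜ.indicator 1 y := fun y =>
    Set.indicator_nonneg (fun _ _ => zero_le_one) y
  induction L using Nat.strong_induction_on generalizing x with
  | _ L ih =>
  rcases le_or_gt L N with hL | hL
  · have h1 := (le_abs_self _).trans (hbd L x)
    have h2 : (L : ℝ) ≤ N := by exact_mod_cast hL
    have h3 : 0 ≤ (2 * C + |q|) * ∑ j ∈ Finset.range L, Gᶜ.indicator 1 (T^[j] x) :=
      mul_nonneg hK (Finset.sum_nonneg fun j _ => hind _)
    have h4 : C * (L + 1) ≤ C * (N + 1) := by gcongr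
    have h5 : -q * L ≤ |q| * L := by gcongr; exact neg_le_abs q
    have h6 : |q| * L ≤ |q| * (N + 1) := by gcongr; linarith
    linarith
  · by_cases hx : x ∈ G
    · obtain ⟨n, hn1, hnN, hn⟩ := hG x hx
      have h1 := ih (L - n) (by omega) (T^[n] x)
      have h2 := hsub n (L - n) x
      have h3 := Finset.sum_range_add (fun j => Gᶜ.indicator (1 : X → ℝ) (T^[j] x)) n (L - n)
      rw [show n + (L - n) = L by omega] at h2 h3
      have h4 : 0 ≤ ∑ j ∈ Finset.range n, Gᶜ.indicator (1 : X → ℝ) (T^[j] x) :=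
        Finset.sum_nonneg fun j _ => hind _
      simp only [← Function.iterate_add_apply, add_comm _ n] at h1
      rw [h3]
      rw [Nat.cast_sub (by omega)] at h1
      nlinarith [mul_nonneg hK h4]
    · have h1 := ih (L - 1) (by omega) (T x)
      have h2 := hsub 1 (L - 1) x
      have h3 := Finset.sum_range_succ' (fun j => Gᶜ.indicator (1 : X → ℝ) (T^[j] x)) (L - 1)
      rw [show 1 + (L - 1) = L by omega] at h2
      rw [show L - 1 + 1 = L by omega] at h3
      rw [Nat.cast_sub (by omega)] at h1
      rw [h3]
      have h4 := (le_abs_self _).trans (hbd 1 x)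
      have h5 : Gᶜ.indicator (1 : X → ℝ) (T^[0] x) = 1 := by simp [hx]
      rw [h5]
      simp only [← Function.iterate_succ_apply] at h1
      simp only [Function.iterate_one] at h2
      push_cast at h1 h4
      linarith

variable [MeasurableSpace X] {μ : Measure X}

theorem integral_comp_of_measurePreserving {S : X → X}
    (hS : MeasurePreserving S μ μ) {f : X → ℝ} (hf : Measurable f) :
    ∫ x, f (S x) ∂μ = ∫ x, f x ∂μ := by
  conv_rhs => rw [← hS.map_eq]
  rw [integral_map hS.measurable.aemeasurable hf.aestronglyMeasurable]

variable [IsProbabilityMeasure μ]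

theorem integrable_of_abs_le {f : X → ℝ} (hf : Measurable f) {D : ℝ} (h : ∀ x, |f x| ≤ D) :
    Integrable f μ :=
  Integrable.of_bound hf.aestronglyMeasurable D (Eventually.of_forall h)

/-- The integrals of a subadditive sequence form a subadditive sequence. -/
theorem subadditive_integral (hT : MeasurePreserving T μ μ) (hg : ∀ n, Measurable (g n))
    (hbd : ∀ n x, |g n x| ≤ C * (n + 1))
    (hsub : ∀ m n x, g (m + n) x ≤ g m x + g n (T^[m] x)) :
    Subadditive fun n => ∫ x, g n x ∂μ := by
  intro m n
  have hi : ∀ n, Integrable (g n) μ := fun n => integrable_of_abs_le (hg n) (hbd n)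
  have h1 : Integrable (fun x => g n (T^[m] x)) μ :=
    (hT.iterate m).integrable_comp_of_integrable (hi n)
  simp only [← integral_comp_of_measurePreserving (hT.iterate m) (hg n)]
  rw [← integral_add (hi m) h1]
  exact integral_mono (hi _) ((hi m).add h1) fun x => hsub m n x

theorem bddBelow_integral_div (hbd : ∀ n x, |g n x| ≤ C * (n + 1)) :
    BddBelow (Set.range fun n : ℕ => (∫ x, g n x ∂μ) / n) := by
  obtain ⟨x⟩ := nonempty_of_isProbabilityMeasure μ
  have hC : 0 ≤ C := by simpa using (abs_nonneg _).trans (hbd 0 x)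
  refine ⟨-(2 * C), ?_⟩
  rintro _ ⟨n, rfl⟩
  rcases Nat.eq_zero_or_pos n with rfl | hn
  · simpa using hC
  have hn' : (1 : ℝ) ≤ n := by exact_mod_cast hn
  have h : |∫ x, g n x ∂μ| ≤ C * (n + 1) := by
    have := norm_integral_le_of_norm_le_const (μ := μ) (f := g n) (C := C * (n + 1))
      (Eventually.of_forall fun x => hbd n x)
    simpa using this
  show _ ≤ _ / _
  rw [le_div_iff₀ (by positivity)]
  nlinarith [neg_le_of_abs_le h]

/-- If almost every orbit starts with a piece on which `g n < q n`, then the normalized integrals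
have limit at most `q`: integrate the covering estimate. -/
theorem lim_le_of_ae_exists_lt (hT : MeasurePreserving T μ μ) (hg : ∀ n, Measurable (g n))
    (hbd : ∀ n x, |g n x| ≤ C * (n + 1))
    (hsub : ∀ m n x, g (m + n) x ≤ g m x + g n (T^[m] x)) (q : ℝ)
    (hq : ∀ᵐ x ∂μ, ∃ n, 1 ≤ n ∧ g n x < q * n) :
    (subadditive_integral hT hg hbd hsub).lim ≤ q := by
  obtain ⟨x₀⟩ := nonempty_of_isProbabilityMeasure μ
  have hC : 0 ≤ C := by simpa using (abs_nonneg _).trans (hbd 0 x₀)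
  set K := 2 * C + |q| with hK
  have hK0 : 0 ≤ K := by positivity
  let G : ℕ → Set X := fun N => {x | ∃ n, 1 ≤ n ∧ n ≤ N ∧ g n x < q * n}
  have hGm : ∀ N, MeasurableSet (G N) := by
    intro N
    have : G N = ⋃ n ∈ Finset.Icc 1 N, {x | g n x < q * n} := by
      ext x; simp [G, and_assoc]
    rw [this]
    exact Finset.measurableSet_biUnion _ fun n _ => measurableSet_lt (hg n) measurable_const
  have hlim : Tendsto (fun N => μ.real (G N)ᶜ) atTop (𝓝 0) := by
    have h0 : μ (⋂ N, (G N)ᶜ) = 0 := by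
      rw [measure_eq_zero_iff_ae_notMem]
      filter_upwards [hq] with x ⟨n, h1, h2⟩ hx
      exact Set.mem_iInter.1 hx n ⟨n, h1, le_rfl, h2⟩
    have h := tendsto_measure_iInter_atTop (μ := μ) (s := fun N => (G N)ᶜ)
      (fun N => (hGm N).compl.nullMeasurableSet)
      (fun a b hab => Set.compl_subset_compl.2 fun x ⟨n, h1, h2, h3⟩ => ⟨n, h1, h2.trans hab, h3⟩)
      ⟨0, measure_ne_top _ _⟩
    rw [h0] at h
    exact (ENNReal.tendsto_toReal ENNReal.zero_ne_top).comp h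
  have key : ∀ N, (subadditive_integral hT hg hbd hsub).lim ≤ q + K * μ.real (G N)ᶜ := by
    intro N
    have h1 : ∀ L : ℕ, ∫ x, g L x ∂μ ≤ q * L + K * (L * μ.real (G N)ᶜ) + (C + |q|) * (N + 1) := by
      intro L
      have hind : ∀ j, Integrable (fun x => (G N)ᶜ.indicator (1 : X → ℝ) (T^[j] x)) μ := fun j =>
        (hT.iterate j).integrable_comp_of_integrable
          ((integrable_const (1 : ℝ)).indicator (hGm N).compl)
      have hintj : ∀ j, ∫ x, (G N)ᶜ.indicator (1 : X → ℝ) (T^[j] x) ∂μ = μ.real (G N)ᶜ := by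
        intro j
        rw [← integral_indicator_one (hGm N).compl]
        exact integral_comp_of_measurePreserving (hT.iterate j)
          (measurable_one.indicator (hGm N).compl)
      calc ∫ x, g L x ∂μ ≤ ∫ x, (q * L + K * ∑ j ∈ Finset.range L,
              (G N)ᶜ.indicator 1 (T^[j] x) + (C + |q|) * (N + 1)) ∂μ := by
            refine integral_mono (integrable_of_abs_le (hg L) (hbd L)) ?_ fun x =>
              le_covering_of_subadditive hbd hsub q N (G N) (fun x hx => hx) L x
            exact ((integrable_const _).add
              ((integrable_finsetSum _ fun j _ => hind j).const_mul K)).add (integrable_const _)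
        _ = _ := by
            have hs := integrable_finsetSum (Finset.range L) fun j _ => hind j
            have hs' : Integrable (fun x => q * L + K * ∑ j ∈ Finset.range L,
                (G N)ᶜ.indicator 1 (T^[j] x)) μ := (integrable_const _).add (hs.const_mul K)
            rw [integral_add hs' (integrable_const _),
              integral_add (integrable_const _) (hs.const_mul K), integral_const_mul K,
              integral_finsetSum _ fun j _ => hind j]
            simp [hintj]
    have h2 : Tendsto (fun L : ℕ => q + K * μ.real (G N)ᶜ + (C + |q|) * (N + 1) / (L : ℝ)) atTop
        (𝓝 (q + K * μ.real (G N)ᶜ + 0)) :=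
      tendsto_const_nhds.add (tendsto_const_div_atTop_nhds_zero_nat _)
    rw [add_zero] at h2
    refine le_of_tendsto_of_tendsto
      ((subadditive_integral hT hg hbd hsub).tendsto_lim (bddBelow_integral_div hbd)) h2 ?_
    filter_upwards [eventually_gt_atTop 0] with L hL
    have hL' : (0 : ℝ) < L := by exact_mod_cast hL
    rw [div_le_iff₀ hL']
    have := h1 L
    have e : (q + K * μ.real (G N)ᶜ + (C + |q|) * (N + 1) / L) * L =
      q * L + K * (L * μ.real (G N)ᶜ) + (C + |q|) * (N + 1) := by field_simp
    rw [e]; exact this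
  have h3 : Tendsto (fun N => q + K * μ.real (G N)ᶜ) atTop (𝓝 (q + K * 0)) :=
    tendsto_const_nhds.add (hlim.const_mul K)
  simpa using ge_of_tendsto' h3 key

/-- The lower half of Kingman's theorem. The points at which `liminf g n / n < q` form a set which
contains its preimage under `T`, hence is null or conull, and it is not conull if `q` is less than
the limit of the normalized integrals. -/
theorem ae_forall_eventually_lt_of_subadditive (hT : Ergodic T μ) (hg : ∀ n, Measurable (g n))
    (hbd : ∀ n x, |g n x| ≤ C * (n + 1))
    (hsub : ∀ m n x, g (m + n) x ≤ g m x + g n (T^[m] x)) :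
    ∀ᵐ x ∂μ, ∀ q < (subadditive_integral hT.toMeasurePreserving hg hbd hsub).lim,
      ∀ᶠ n : ℕ in atTop, q * n ≤ g n x := by
  obtain ⟨x₀⟩ := nonempty_of_isProbabilityMeasure μ
  have hC : 0 ≤ C := by simpa using (abs_nonneg _).trans (hbd 0 x₀)
  set γ := (subadditive_integral hT.toMeasurePreserving hg hbd hsub).lim with hγ
  have key : ∀ q : ℚ, (q : ℝ) < γ →
      ∀ᵐ x ∂μ, ∀ p : ℚ, p < q → ∀ᶠ n : ℕ in atTop, (p : ℝ) * n ≤ g n x := by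
    intro q hq
    let E : Set X := {x | ∃ p : ℚ, p < q ∧ ∃ᶠ n : ℕ in atTop, g n x < p * n}
    have hE : MeasurableSet E := by
      have : E = ⋃ p : ℚ, ⋃ _ : p < q, ⋂ N : ℕ, ⋃ n : ℕ, ⋃ _ : N ≤ n, {x | g n x < p * n} := by
        ext x
        simp only [E, Set.mem_ofPred_eq, frequently_atTop, Set.mem_iUnion, Set.mem_iInter,
          exists_prop]
      rw [this]
      exact .iUnion fun p => .iUnion fun _ => .iInter fun N => .iUnion fun n => .iUnion fun _ =>
        measurableSet_lt (hg n) measurable_const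
    -- passing from `T x` to `x` costs a bounded amount, absorbed by a slightly larger slope `p'`
    have hinv : T ⁻¹' E ⊆ E := by
      rintro x ⟨p, hp, hx⟩
      obtain ⟨p', hp1, hp2⟩ := exists_between hp
      refine ⟨p', hp2, ?_⟩
      have hev : ∀ᶠ n : ℕ in atTop, 2 * C + |(p : ℝ)| < (p' - p) * (n : ℝ) := by
        have : (0 : ℝ) < p' - p := by rw [sub_pos]; exact_mod_cast hp1
        exact (tendsto_natCast_atTop_atTop.const_mul_atTop this).eventually_gt_atTop _
      have h := hx.and_eventually hev
      rw [frequently_atTop] at h ⊢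
      intro N
      obtain ⟨n, hn, h1, h2⟩ := h N
      refine ⟨n + 1, by omega, ?_⟩
      have h3 := hsub 1 n x
      have h4 := (le_abs_self _).trans (hbd 1 x)
      have h5 : -|(p' : ℝ)| ≤ p' := neg_abs_le _
      have h6 : (p : ℝ) < p' := by exact_mod_cast hp1
      have h7 := neg_abs_le (p : ℝ)
      rw [add_comm 1 n, Function.iterate_one] at h3
      push_cast at h4 ⊢
      nlinarith
    rcases hT.ae_empty_or_univ_of_preimage_ae_le hE.nullMeasurableSet
      (Eventually.of_forall hinv) with h | h
    · have h0 : μ E = 0 := by rw [measure_congr h, measure_empty]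
      filter_upwards [measure_eq_zero_iff_ae_notMem.1 h0] with x hx p hp
      by_contra hcon
      rw [not_eventually] at hcon
      exact hx ⟨p, hp, hcon.mono fun n hn => not_le.1 hn⟩
    · exfalso
      refine hq.not_ge (lim_le_of_ae_exists_lt hT.toMeasurePreserving hg hbd hsub q ?_)
      filter_upwards [h] with x hx
      obtain ⟨p, hp, hx⟩ : x ∈ E := by
        have : (x ∈ E) = (x ∈ Set.univ) := hx
        rw [this]; trivial
      obtain ⟨n, hn, hlt⟩ := frequently_atTop.1 hx 1
      refine ⟨n, hn, hlt.trans_le ?_⟩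
      have : (p : ℝ) ≤ q := by exact_mod_cast hp.le
      gcongr
  have key' : ∀ᵐ x ∂μ, ∀ q : ℚ, (q : ℝ) < γ → ∀ p : ℚ, p < q →
      ∀ᶠ n : ℕ in atTop, (p : ℝ) * n ≤ g n x := by
    rw [ae_all_iff]; intro q
    by_cases hq : (q : ℝ) < γ
    · filter_upwards [key q hq] with x hx _ using hx
    · exact Eventually.of_forall fun x h => (hq h).elim
  filter_upwards [key'] with x hx t ht
  obtain ⟨p, hp1, hp2⟩ := exists_rat_btwn ht
  obtain ⟨q, hq1, hq2⟩ := exists_rat_btwn hp2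
  filter_upwards [hx q hq2 p (by exact_mod_cast hq1)] with n hn
  refine le_trans ?_ hn
  gcongr

/-- The upper half of Birkhoff's theorem for bounded functions: apply the lower half of Kingman's
result to the negated Birkhoff sums. -/
theorem ae_eventually_sum_le_of_ergodic (hT : Ergodic T μ) {f : X → ℝ} (hf : Measurable f)
    {D : ℝ} (hD : ∀ x, |f x| ≤ D) :
    ∀ᵐ x ∂μ, ∀ q > ∫ x, f x ∂μ,
      ∀ᶠ n : ℕ in atTop, ∑ j ∈ Finset.range n, f (T^[j] x) ≤ q * n := by
  obtain ⟨x₀⟩ := nonempty_of_isProbabilityMeasure μ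
  have hD0 : 0 ≤ D := (abs_nonneg _).trans (hD x₀)
  let g : ℕ → X → ℝ := fun n x => -∑ j ∈ Finset.range n, f (T^[j] x)
  have hfj : ∀ j, Measurable fun x => f (T^[j] x) := fun j => hf.comp (hT.measurable.iterate j)
  have hg : ∀ n, Measurable (g n) := fun n => (Finset.measurable_sum _ fun j _ => hfj j).neg
  have hbd : ∀ n x, |g n x| ≤ D * (n + 1) := by
    intro n x
    simp only [g, abs_neg]
    refine (Finset.abs_sum_le_sum_abs _ _).trans ((Finset.sum_le_sum fun j _ => hD _).trans ?_)
    simp; linarith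
  have hsub : ∀ m n x, g (m + n) x ≤ g m x + g n (T^[m] x) := by
    intro m n x
    simp only [g, Finset.sum_range_add, ← Function.iterate_add_apply, add_comm _ m]
    simp
  have hlim : (subadditive_integral hT.toMeasurePreserving hg hbd hsub).lim = -∫ x, f x ∂μ := by
    refine tendsto_nhds_unique
      ((subadditive_integral hT.toMeasurePreserving hg hbd hsub).tendsto_lim
        (bddBelow_integral_div hbd)) (tendsto_const_nhds.congr' ?_)
    filter_upwards [eventually_gt_atTop 0] with n hn
    have hi : Integrable f μ := integrable_of_abs_le hf hD
    have hintj : ∀ j, ∫ x, f (T^[j] x) ∂μ = ∫ x, f x ∂μ := fun j =>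
      integral_comp_of_measurePreserving (hT.toMeasurePreserving.iterate j) hf
    simp only [g]
    rw [integral_neg, integral_finsetSum _ fun j _ => integrable_of_abs_le (hfj j) fun x => hD _]
    simp only [hintj, Finset.sum_const, Finset.card_range, nsmul_eq_mul]
    field_simp
  filter_upwards [ae_forall_eventually_lt_of_subadditive hT hg hbd hsub] with x hx q hq
  rw [hlim] at hx
  filter_upwards [hx (-q) (by linarith)] with n hn
  simp only [g] at hn
  linarith

/-- If the Birkhoff sums of every `g k` along the orbit of `x` grow at most like `∫ g k`, then
`limsup g n x / n` is at most the limit of the normalized integrals. -/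
theorem eventually_le_of_forall_sum_le (hT : MeasurePreserving T μ μ) (hg : ∀ n, Measurable (g n))
    (hbd : ∀ n x, |g n x| ≤ C * (n + 1))
    (hsub : ∀ m n x, g (m + n) x ≤ g m x + g n (T^[m] x)) (x : X)
    (hx : ∀ k, ∀ q > ∫ x, g k x ∂μ,
      ∀ᶠ n : ℕ in atTop, ∑ j ∈ Finset.range n, g k (T^[j] x) ≤ q * n)
    {q : ℝ} (hq : (subadditive_integral hT hg hbd hsub).lim < q) :
    ∀ᶠ n : ℕ in atTop, g n x ≤ q * n := by
  obtain ⟨k, hk, hk0⟩ := (((subadditive_integral hT hg hbd hsub).tendsto_lim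
    (bddBelow_integral_div hbd)).eventually_lt_const hq |>.and (eventually_gt_atTop 0)).exists
  have hk0' : (0 : ℝ) < k := by exact_mod_cast hk0
  rw [div_lt_iff₀ hk0'] at hk
  obtain ⟨p, hp1, hp2⟩ := exists_between hk
  have hev : ∀ᶠ n : ℕ in atTop, 3 * (k * (C * (k + 1))) < (q * k - p) * (n : ℝ) :=
    (tendsto_natCast_atTop_atTop.const_mul_atTop (sub_pos.2 hp2)).eventually_gt_atTop _
  filter_upwards [hx k p hp1, hev, eventually_ge_atTop k] with n h1 h2 h3
  have h4 := mul_le_sum_of_subadditive hbd hsub k n h3 x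
  have h5 : (k : ℝ) * g n x ≤ k * (q * n) := by linarith
  exact le_of_mul_le_mul_left h5 hk0'

end Subadditive

/-! ### The torus, its endomorphisms and uniform distribution -/

section Torus

variable {r : ℕ}

/-- The projection of `ℝ^r` onto the torus `(ℝ/ℤ)^r`. -/
def torusMk (x : Fin r → ℝ) : UnitAddTorus (Fin r) := fun i => (x i : UnitAddCircle)

theorem torusMk_torusRep (s : UnitAddTorus (Fin r)) : torusMk (torusRep s) = s :=
  funext fun i => (AddCircle.equivIco 1 0).symm_apply_apply (s i)

theorem torusRep_torusMk (x : Fin r → ℝ) (i : Fin r) :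
    torusRep (torusMk x) i = Int.fract (x i) := by
  exact (AddCircle.coe_equivIco_mk_apply (1 : ℝ) (x i)).trans (by simp)

theorem torusRep_mem_Ico (s : UnitAddTorus (Fin r)) (i : Fin r) :
    torusRep s i ∈ Set.Ico (0 : ℝ) 1 := by
  have h := (AddCircle.equivIco (1 : ℝ) 0 (s i)).2
  exact ⟨h.1, h.2.trans_eq (zero_add 1)⟩

theorem torusMk_surjective : Function.Surjective (torusMk (r := r)) :=
  fun s => ⟨_, torusMk_torusRep s⟩

theorem continuous_torusMk : Continuous (torusMk (r := r)) :=
  continuous_pi fun i => (AddCircle.continuous_mk' 1).comp (continuous_apply i)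

theorem mFourier_torusMk (k : Fin r → ℤ) (x : Fin r → ℝ) :
    UnitAddTorus.mFourier k (torusMk x) =
      Complex.exp (2 * Real.pi * Complex.I * ((∑ i, (k i : ℝ) * x i : ℝ) : ℂ)) := by
  simp only [UnitAddTorus.mFourier, ContinuousMap.coe_mk, torusMk]
  simp only [fourier_coe_apply]
  rw [← Complex.exp_sum]
  congr 1
  push_cast
  rw [Finset.mul_sum]
  exact Finset.sum_congr rfl fun i _ => by ring

/-- The endomorphism of the torus induced by an integer matrix. -/
def torusEnd (B : Matrix (Fin r) (Fin r) ℤ) : UnitAddTorus (Fin r) →+ UnitAddTorus (Fin r) where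
  toFun s i := ∑ j, B i j • s j
  map_zero' := by ext i; simp
  map_add' s t := by ext i; simp [Finset.sum_add_distrib]

theorem torusEnd_torusMk (B : Matrix (Fin r) (Fin r) ℤ) (x : Fin r → ℝ) :
    torusEnd B (torusMk x) = torusMk ((B.map (fun m : ℤ => (m : ℝ))).mulVec x) := by
  funext i
  show ∑ j, B i j • (x j : UnitAddCircle) = ((∑ j, (B i j : ℝ) * x j : ℝ) : UnitAddCircle)
  have : ∀ j, B i j • (x j : UnitAddCircle) = (((B i j : ℝ) * x j : ℝ) : UnitAddCircle) := by
    intro j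
    rw [← zsmul_eq_mul]; rfl
  simp only [this]
  exact (map_sum (QuotientAddGroup.mk' (AddSubgroup.zmultiples (1 : ℝ)))
    (fun j => (B i j : ℝ) * x j) Finset.univ).symm

theorem continuous_torusEnd (B : Matrix (Fin r) (Fin r) ℤ) : Continuous (torusEnd B) :=
  continuous_pi fun i => by
    show Continuous fun s : UnitAddTorus (Fin r) => ∑ j, B i j • s j
    fun_prop

/-- The dual endomorphism acts on the frequencies by the transposed matrix. -/
theorem mFourier_torusEnd (B : Matrix (Fin r) (Fin r) ℤ) (k : Fin r → ℤ)
    (s : UnitAddTorus (Fin r)) :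
    UnitAddTorus.mFourier k (torusEnd B s) = UnitAddTorus.mFourier (B.transpose.mulVec k) s := by
  obtain ⟨x, rfl⟩ := torusMk_surjective s
  rw [torusEnd_torusMk, mFourier_torusMk, mFourier_torusMk]
  congr 3
  simp only [Matrix.mulVec, dotProduct, Matrix.transpose_apply, Matrix.map_apply]
  push_cast
  simp only [Finset.mul_sum, Finset.sum_mul]
  rw [Finset.sum_comm]
  exact Finset.sum_congr rfl fun i _ => Finset.sum_congr rfl fun j _ => by ring

instance : IsProbabilityMeasure (torusHaar r) := by
  unfold torusHaar; infer_instance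

instance : (torusHaar r).IsAddHaarMeasure := by
  unfold torusHaar; infer_instance

theorem det_map_intCast (B : Matrix (Fin r) (Fin r) ℤ) :
    (B.map (fun m : ℤ => (m : ℝ))).det = (B.det : ℝ) :=
  ((Int.castRingHom ℝ).map_det B).symm

theorem measurePreserving_torusEnd (B : Matrix (Fin r) (Fin r) ℤ) (hB : B.det ≠ 0) :
    MeasurePreserving (torusEnd B) (torusHaar r) (torusHaar r) := by
  refine AddMonoidHom.measurePreserving (continuous_torusEnd B) ?_ rfl
  intro s
  obtain ⟨y, rfl⟩ := torusMk_surjective s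
  set A : Matrix (Fin r) (Fin r) ℝ := B.map (fun m : ℤ => (m : ℝ))
  have hA : IsUnit A.det := by
    rw [det_map_intCast, isUnit_iff_ne_zero]
    exact_mod_cast hB
  refine ⟨torusMk (A⁻¹.mulVec y), ?_⟩
  rw [torusEnd_torusMk, Matrix.mulVec_mulVec, Matrix.mul_nonsing_inv A hA, Matrix.one_mulVec]

theorem haarAddCircle_Ico {a c : ℝ} (ha : 0 ≤ a) (hc : c ≤ 1) :
    AddCircle.haarAddCircle {s : UnitAddCircle | (AddCircle.equivIco 1 0 s : ℝ) ∈ Set.Ico a c} =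
      ENNReal.ofReal (c - a) := by
  have hv : (volume : Measure UnitAddCircle) = AddCircle.haarAddCircle := by
    rw [AddCircle.volume_eq_smul_haarAddCircle]; simp
  have hm := AddCircle.measurePreserving_mk 1 0
  have h01 : (0 : ℝ) + 1 = 1 := zero_add 1
  have hmeas : MeasurableSet
      {s : UnitAddCircle | (AddCircle.equivIco 1 0 s : ℝ) ∈ Set.Ico a c} := by
    exact (measurable_subtype_coe.comp (AddCircle.measurableEquivIco 1 0).measurable)
      measurableSet_Ico
  rw [← hv, ← hm.measure_preimage hmeas.nullMeasurableSet,
    ← Measure.restrict_congr_set (Ico_ae_eq_Ioc (μ := volume) (a := (0 : ℝ)) (b := 0 + 1)),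
    Measure.restrict_apply (hm.measurable hmeas)]
  have : (fun x : ℝ => (x : UnitAddCircle)) ⁻¹'
      {s : UnitAddCircle | (AddCircle.equivIco 1 0 s : ℝ) ∈ Set.Ico a c} ∩ Set.Ico 0 (0 + 1) =
      Set.Ico a c := by
    ext x
    have hx : (AddCircle.equivIco (1 : ℝ) 0 (x : UnitAddCircle) : ℝ) = Int.fract x := by
      simp
    simp only [Set.mem_inter_iff, Set.mem_preimage, Set.mem_ofPred_eq, hx, Set.mem_Ico, h01]
    constructor
    · rintro ⟨h1, h2⟩
      rwa [Int.fract_eq_self.2 h2] at h1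
    · intro h
      have h2 : 0 ≤ x ∧ x < 1 := ⟨ha.trans h.1, h.2.trans_le hc⟩
      rw [Int.fract_eq_self.2 h2]
      exact ⟨h, h2⟩
  rw [this, Real.volume_Ico]

theorem torusHaar_box {a c : Fin r → ℝ} (h : ∀ i, 0 ≤ a i ∧ a i ≤ c i ∧ c i ≤ 1) :
    (torusHaar r).real {s | ∀ i, torusRep s i ∈ Set.Ico (a i) (c i)} = ∏ i, (c i - a i) := by
  have : {s : UnitAddTorus (Fin r) | ∀ i, torusRep s i ∈ Set.Ico (a i) (c i)} =
      Set.univ.pi fun i => {s : UnitAddCircle | (AddCircle.equivIco 1 0 s : ℝ) ∈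
        Set.Ico (a i) (c i)} := by
    ext s; simp [torusRep]
  rw [this, Measure.real, torusHaar, Measure.pi_pi, ENNReal.toReal_prod]
  refine Finset.prod_congr rfl fun i _ => ?_
  rw [haarAddCircle_Ico (h i).1 (h i).2.2,
    ENNReal.toReal_ofReal (sub_nonneg.2 (h i).2.1)]

theorem measurable_torusRep : Measurable (torusRep (r := r)) :=
  measurable_pi_lambda _ fun i => measurable_subtype_coe.comp
    ((AddCircle.measurableEquivIco 1 0).measurable.comp (measurable_pi_apply i))

theorem dist_torusMk_le (x y : Fin r → ℝ) : dist (torusMk x) (torusMk y) ≤ dist x y := by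
  refine (dist_pi_le_iff dist_nonneg).2 fun i => ?_
  refine le_trans ?_ (dist_le_pi_dist x y i)
  rw [dist_eq_norm, dist_eq_norm]
  exact QuotientAddGroup.norm_mk_le_norm (S := AddSubgroup.zmultiples (1 : ℝ)) (m := x i - y i)

/-- The index of the cell containing `s` when the torus is cut into `M ^ r` cubes. -/
noncomputable def cellIndex {M : ℕ} (hM : 0 < M) (s : UnitAddTorus (Fin r)) : Fin r → Fin M :=
  fun j => ⟨⌊M * torusRep s j⌋₊, by
    have hM' : (0 : ℝ) < M := by exact_mod_cast hM
    have h := torusRep_mem_Ico s j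
    rw [Nat.floor_lt (mul_nonneg hM'.le h.1)]
    nlinarith [h.2]⟩

theorem cellIndex_eq_iff {M : ℕ} (hM : 0 < M) (s : UnitAddTorus (Fin r)) (i : Fin r → Fin M) :
    cellIndex hM s = i ↔ ∀ j, torusRep s j ∈ Set.Ico ((i j : ℝ) / M) (((i j : ℝ) + 1) / M) := by
  have hM' : (0 : ℝ) < M := by exact_mod_cast hM
  rw [funext_iff]
  refine forall_congr' fun j => ?_
  rw [Fin.ext_iff]
  show ⌊M * torusRep s j⌋₊ = (i j : ℕ) ↔ _
  rw [Nat.floor_eq_iff (mul_nonneg hM'.le (torusRep_mem_Ico s j).1), Set.mem_Ico,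
    div_le_iff₀ hM', lt_div_iff₀ hM', mul_comm]

theorem dist_cellIndex_le {M : ℕ} (hM : 0 < M) (s : UnitAddTorus (Fin r)) :
    dist s (torusMk fun j => (cellIndex hM s j : ℝ) / M) ≤ 1 / M := by
  conv_lhs => rw [← torusMk_torusRep s]
  refine (dist_torusMk_le _ _).trans ((dist_pi_le_iff (by positivity)).2 fun j => ?_)
  rw [torusMk_torusRep]
  have h := (cellIndex_eq_iff hM s _).1 rfl j
  rw [Real.dist_eq, abs_of_nonneg (sub_nonneg.2 h.1)]
  have := h.2
  rw [add_div] at this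
  linarith

/-- Averages of a continuous function along a sequence which is uniformly distributed modulo `1`
are asymptotically at most its integral: compare the function with a step function. -/
theorem UDModOne.eventually_sum_le {x : ℕ → Fin r → ℝ} (hx : UDModOne x)
    {f : UnitAddTorus (Fin r) → ℝ} (hf : Continuous f) {q : ℝ}
    (hq : ∫ s, f s ∂(torusHaar r) < q) :
    ∀ᶠ N : ℕ in atTop, ∑ n ∈ Finset.range N, f (torusMk (x n)) ≤ q * N := by
  classical
  set ε := (q - ∫ s, f s ∂(torusHaar r)) / 3 with hε
  have hε0 : 0 < ε := by rw [hε]; linarith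
  obtain ⟨δ, hδ, hfδ⟩ := Metric.uniformContinuous_iff.1
    (CompactSpace.uniformContinuous_of_continuous hf) ε hε0
  obtain ⟨M', hM'⟩ := exists_nat_one_div_lt hδ
  set M := M' + 1 with hMdef
  have hM : 0 < M := Nat.succ_pos _
  have hMδ : (1 : ℝ) / M < δ := by rw [hMdef]; exact_mod_cast hM'
  have hMr : (0 : ℝ) < M := by exact_mod_cast hM
  let v : (Fin r → Fin M) → ℝ := fun i => f (torusMk fun j => (i j : ℝ) / M)
  let h : UnitAddTorus (Fin r) → ℝ := fun s => v (cellIndex hM s)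
  have hfh : ∀ s, |f s - h s| < ε := fun s => by
    have := hfδ ((dist_cellIndex_le hM s).trans_lt hMδ)
    rwa [Real.dist_eq] at this
  have hbox : ∀ i : Fin r → Fin M, ∀ j, 0 ≤ (i j : ℝ) / M ∧
      (i j : ℝ) / M ≤ ((i j : ℝ) + 1) / M ∧ ((i j : ℝ) + 1) / M ≤ 1 := by
    intro i j
    refine ⟨by positivity, by gcongr; linarith, ?_⟩
    rw [div_le_one hMr]
    exact_mod_cast (i j).2
  have hset : ∀ i : Fin r → Fin M, {s | cellIndex hM s = i} =
      {s | ∀ j, torusRep s j ∈ Set.Ico ((i j : ℝ) / M) (((i j : ℝ) + 1) / M)} := fun i =>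
    Set.ext fun s => cellIndex_eq_iff hM s i
  have hmeas : ∀ i : Fin r → Fin M, MeasurableSet {s | cellIndex hM s = i} := by
    intro i
    rw [hset]
    have : {s : UnitAddTorus (Fin r) | ∀ j, torusRep s j ∈
        Set.Ico ((i j : ℝ) / M) (((i j : ℝ) + 1) / M)} = torusRep ⁻¹' Set.univ.pi fun j =>
          Set.Ico ((i j : ℝ) / M) (((i j : ℝ) + 1) / M) := by ext s; simp
    rw [this]
    exact measurable_torusRep (MeasurableSet.univ_pi fun j => measurableSet_Ico)
  have hsum : ∀ s, h s =
      ∑ i, v i * {s | cellIndex hM s = i}.indicator (1 : UnitAddTorus (Fin r) → ℝ) s := by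
    intro s
    simp [h, Set.indicator_apply]
  have hind : ∀ i ∈ (Finset.univ : Finset (Fin r → Fin M)), Integrable
      (fun s => v i * {s | cellIndex hM s = i}.indicator (1 : UnitAddTorus (Fin r) → ℝ) s)
      (torusHaar r) := fun i _ =>
    (((integrable_const (1 : ℝ)).indicator (hmeas i))).const_mul _
  have hint : Integrable h (torusHaar r) := by
    rw [funext hsum]; exact integrable_finsetSum _ hind
  have hIh : ∫ s, h s ∂(torusHaar r) =
      ∑ i : Fin r → Fin M, v i * ∏ j, (((i j : ℝ) + 1) / M - (i j : ℝ) / M) := by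
    simp only [hsum]
    rw [integral_finsetSum _ hind]
    refine Finset.sum_congr rfl fun i _ => ?_
    rw [integral_const_mul, integral_indicator_one (hmeas i), hset, torusHaar_box (hbox i)]
  have hle : ∫ s, h s ∂(torusHaar r) ≤ ∫ s, f s ∂(torusHaar r) + ε := by
    have hfi : Integrable f (torusHaar r) := hf.integrable_of_hasCompactSupport
      (HasCompactSupport.of_compactSpace f)
    calc ∫ s, h s ∂(torusHaar r) ≤ ∫ s, (f s + ε) ∂(torusHaar r) :=
          integral_mono hint (hfi.add (integrable_const _)) fun s => by
            have := abs_lt.1 (hfh s); simp only; linarith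
      _ = _ := by rw [integral_add hfi (integrable_const _)]; simp
  have hlim : Tendsto (fun N : ℕ => (∑ n ∈ Finset.range N, h (torusMk (x n))) / N) atTop
      (𝓝 (∫ s, h s ∂(torusHaar r))) := by
    rw [hIh]
    have := tendsto_finsetSum (Finset.univ : Finset (Fin r → Fin M)) fun i _ =>
      (hx _ _ (hbox i)).const_mul (v i)
    refine this.congr fun N => ?_
    have hcard : ∀ i : Fin r → Fin M, (Set.ncard {n : ℕ | n < N ∧ ∀ j, Int.fract (x n j) ∈
        Set.Ico ((i j : ℝ) / M) (((i j : ℝ) + 1) / M)} : ℝ) =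
        ∑ n ∈ Finset.range N, if cellIndex hM (torusMk (x n)) = i then 1 else 0 := by
      intro i
      rw [Finset.sum_boole, ← Set.ncard_coe_finset]
      congr 2
      ext n
      simp [cellIndex_eq_iff, torusRep_torusMk]
    simp only [hcard]
    simp only [← mul_div_assoc, Finset.mul_sum]
    rw [← Finset.sum_div, Finset.sum_comm]
    congr 1
    refine Finset.sum_congr rfl fun n _ => ?_
    simp [h]
  have hlt : ∫ s, h s ∂(torusHaar r) < q - ε := by linarith
  filter_upwards [hlim.eventually_lt_const hlt, eventually_gt_atTop 0] with N hN hN0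
  have hN0' : (0 : ℝ) < N := by exact_mod_cast hN0
  rw [div_lt_iff₀ hN0'] at hN
  have : ∑ n ∈ Finset.range N, f (torusMk (x n)) ≤
      ∑ n ∈ Finset.range N, (h (torusMk (x n)) + ε) := Finset.sum_le_sum fun n _ => by
    have := abs_lt.1 (hfh (torusMk (x n))); linarith
  rw [Finset.sum_add_distrib, Finset.sum_const, Finset.card_range, nsmul_eq_mul] at this
  linarith

end Torus

/-! ### Trigonometric polynomials with integer coefficients and their Mahler measure -/

section Mahler

variable {r : ℕ}

/-- Jensen's formula bounds the logarithmic mean of a complex polynomial over the unit circle from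
below by the logarithm of its leading coefficient; flooring the absolute value at `ε` only increases
the mean. -/
theorem integral_log_max_norm_eval_nonneg {p : Polynomial ℂ} (hp : 1 ≤ ‖p.leadingCoeff‖)
    {ε : ℝ} (hε : 0 < ε) :
    0 ≤ ∫ θ in (0 : ℝ)..2 * Real.pi, Real.log (max ‖p.eval (circleMap 0 1 θ)‖ ε) := by
  have hp0 : p ≠ 0 := by
    rintro rfl
    simp at hp
    linarith
  have h1 : 0 ≤ p.logMahlerMeasure := by
    rw [Polynomial.logMahlerMeasure_eq_log_MahlerMeasure]
    exact Real.log_nonneg (hp.trans (Polynomial.leadingCoeff_le_mahlerMeasure p))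
  have h2 : 0 ≤ ∫ θ in (0 : ℝ)..2 * Real.pi, Real.log ‖p.eval (circleMap 0 1 θ)‖ := by
    rw [Polynomial.logMahlerMeasure_def, Real.circleAverage, smul_eq_mul] at h1
    exact nonneg_of_mul_nonneg_right h1 (by positivity)
  refine h2.trans ?_
  have hcont : Continuous fun θ : ℝ => Real.log (max ‖p.eval (circleMap 0 1 θ)‖ ε) := by
    refine Continuous.log ?_ fun θ => (lt_max_of_lt_right hε).ne'
    have := continuous_circleMap 0 1
    fun_prop
  -- `Real.log 0 = 0` breaks the pointwise inequality at the zeros, which form a countable set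
  have hzero : {θ : ℝ | p.eval (circleMap 0 1 θ) = 0}.Countable := by
    have : {θ : ℝ | p.eval (circleMap 0 1 θ) = 0} = circleMap 0 1 ⁻¹' {z | p.IsRoot z} := rfl
    rw [this]
    exact (Polynomial.finite_setOfPred_isRoot hp0).countable.preimage_circleMap 0 one_ne_zero
  refine intervalIntegral.integral_mono_ae (by positivity) p.intervalIntegrable_mahlerMeasure
    (hcont.intervalIntegrable _ _) ?_
  filter_upwards [hzero.ae_notMem volume] with θ hθ
  exact Real.log_le_log (norm_pos_iff.2 hθ) (le_max_left _ _)

/-- Some integer linear functional separates the points of a finite set of integer vectors. -/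
theorem exists_injOn_dotProduct (S : Finset (Fin r → ℤ)) :
    ∃ m : Fin r → ℤ, Set.InjOn (fun k => ∑ i, k i * m i) (S : Set (Fin r → ℤ)) := by
  classical
  -- a nonzero polynomial whose non-roots are the functionals separating the points of `S`
  let P : MvPolynomial (Fin r) ℤ :=
    ∏ z ∈ S.offDiag, ∑ i, MvPolynomial.C (z.1 i - z.2 i) * MvPolynomial.X i
  have hP : P ≠ 0 := by
    refine Finset.prod_ne_zero_iff.2 fun z hz h => ?_
    obtain ⟨_, _, hne⟩ := Finset.mem_offDiag.1 hz
    obtain ⟨i, hi⟩ := Function.ne_iff.1 hne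
    have := congrArg (MvPolynomial.eval (Pi.single i 1)) h
    simp [Pi.single_apply] at this
    omega
  obtain ⟨m, hm⟩ : ∃ m, MvPolynomial.eval m P ≠ 0 := by
    by_contra! h
    exact hP (MvPolynomial.funext fun m => by simpa using h m)
  refine ⟨m, fun k hk k' hk' h => ?_⟩
  by_contra hne
  rw [map_prod, Finset.prod_ne_zero_iff] at hm
  refine hm (k, k') (Finset.mem_offDiag.2 ⟨hk, hk', hne⟩) ?_
  simp only [map_sum, map_mul, MvPolynomial.eval_C, MvPolynomial.eval_X, sub_mul,
    Finset.sum_sub_distrib]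
  simpa [sub_eq_zero] using h

/-- The ring of trigonometric polynomials with integer coefficients on the torus. -/
def integralTrigPoly (r : ℕ) : Subring (UnitAddTorus (Fin r) → ℂ) :=
  Subring.closure (Set.range fun k => ⇑(UnitAddTorus.mFourier k))

theorem mFourier_mem_integralTrigPoly (k : Fin r → ℤ) :
    ⇑(UnitAddTorus.mFourier k) ∈ integralTrigPoly r :=
  Subring.subset_closure ⟨k, rfl⟩

theorem continuous_of_mem_integralTrigPoly {F : UnitAddTorus (Fin r) → ℂ}
    (hF : F ∈ integralTrigPoly r) : Continuous F := by
  induction hF using Subring.closure_induction with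
  | mem x hx => obtain ⟨k, rfl⟩ := hx; exact (UnitAddTorus.mFourier k).continuous
  | zero => exact continuous_const
  | one => exact continuous_const
  | add x y _ _ hx hy => exact hx.add hy
  | neg x _ hx => exact hx.neg
  | mul x y _ _ hx hy => exact hx.mul hy

theorem comp_torusEnd_mem_integralTrigPoly (B : Matrix (Fin r) (Fin r) ℤ)
    {F : UnitAddTorus (Fin r) → ℂ} (hF : F ∈ integralTrigPoly r) :
    (fun s => F (torusEnd B s)) ∈ integralTrigPoly r := by
  induction hF using Subring.closure_induction with
  | mem x hx =>
    obtain ⟨k, rfl⟩ := hx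
    simp only [mFourier_torusEnd]
    exact mFourier_mem_integralTrigPoly _
  | zero => exact Subring.zero_mem _
  | one => exact Subring.one_mem _
  | add x y _ _ hx hy => exact Subring.add_mem _ hx hy
  | neg x _ hx => exact Subring.neg_mem _ hx
  | mul x y _ _ hx hy => exact Subring.mul_mem _ hx hy

theorem exists_coeff_of_mem_integralTrigPoly {F : UnitAddTorus (Fin r) → ℂ}
    (hF : F ∈ integralTrigPoly r) :
    ∃ c : (Fin r → ℤ) →₀ ℤ, ∀ s, F s = ∑ k ∈ c.support, (c k : ℂ) * UnitAddTorus.mFourier k s := by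
  have key : F ∈ Submodule.span ℤ (Set.range fun k : Fin r → ℤ => ⇑(UnitAddTorus.mFourier k)) := by
    rw [integralTrigPoly, Subring.mem_closure_iff] at hF
    rw [← Submodule.mem_toAddSubgroup, Submodule.span_int_eq_addSubgroupClosure]
    refine AddSubgroup.closure_mono (fun G hG => ?_) hF
    induction hG using Submonoid.closure_induction with
    | mem x hx => exact hx
    | one => exact ⟨0, congrArg _ UnitAddTorus.mFourier_zero⟩
    | mul x y _ _ hx hy =>
      obtain ⟨k, rfl⟩ := hx
      obtain ⟨l, rfl⟩ := hy
      exact ⟨k + l, funext fun s => UnitAddTorus.mFourier_add⟩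
  obtain ⟨c, rfl⟩ := Finsupp.mem_span_range_iff_exists_finsupp.1 key
  refine ⟨c, fun s => ?_⟩
  simp [Finsupp.sum, Finset.sum_apply]

theorem norm_mFourier_apply (k : Fin r → ℤ) (s : UnitAddTorus (Fin r)) :
    ‖UnitAddTorus.mFourier k s‖ = 1 := by
  simp only [UnitAddTorus.mFourier, ContinuousMap.coe_mk, fourier_apply, norm_prod]
  exact Finset.prod_eq_one fun i _ => Circle.norm_coe _

theorem mFourier_add_apply (k : Fin r → ℤ) (s t : UnitAddTorus (Fin r)) :
    UnitAddTorus.mFourier k (s + t) = UnitAddTorus.mFourier k s * UnitAddTorus.mFourier k t := by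
  simp only [UnitAddTorus.mFourier, ContinuousMap.coe_mk, Pi.add_apply, fourier_apply,
    ← Finset.prod_mul_distrib, smul_add, AddCircle.toCircle_add, Circle.coe_mul]

/-- Along a generic rational direction, a nonzero trigonometric polynomial with integer coefficients
is, up to a factor of modulus `1`, the restriction to the unit circle of a polynomial whose leading
coefficient has modulus at least `1`. -/
theorem exists_direction_of_mem_integralTrigPoly {F : UnitAddTorus (Fin r) → ℂ}
    (hF : F ∈ integralTrigPoly r) (hF0 : F ≠ 0) :
    ∃ m : Fin r → ℝ, ∀ s, ∃ p : Polynomial ℂ, 1 ≤ ‖p.leadingCoeff‖ ∧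
      ∀ θ : ℝ, ‖F (s + torusMk ((θ / (2 * Real.pi)) • m))‖ = ‖p.eval (circleMap 0 1 θ)‖ := by
  classical
  obtain ⟨c, hc⟩ := exists_coeff_of_mem_integralTrigPoly hF
  obtain ⟨m, hm⟩ := exists_injOn_dotProduct c.support
  set φ : (Fin r → ℤ) → ℤ := fun k => ∑ i, k i * m i with hφ
  have hne : c.support.Nonempty := by
    by_contra h
    rw [Finset.not_nonempty_iff_eq_empty] at h
    exact hF0 (funext fun s => by rw [hc, h]; simp)
  obtain ⟨k₁, hk₁, hmax⟩ := c.support.exists_max_image φ hne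
  obtain ⟨k₀, hk₀, hmin⟩ := c.support.exists_min_image φ hne
  refine ⟨fun i => m i, fun s => ?_⟩
  let e : (Fin r → ℤ) → ℕ := fun k => (φ k - φ k₀).toNat
  have he : ∀ k ∈ c.support, (e k : ℤ) = φ k - φ k₀ := fun k hk =>
    Int.toNat_of_nonneg (sub_nonneg.2 (hmin k hk))
  let a : (Fin r → ℤ) → ℂ := fun k => (c k : ℂ) * UnitAddTorus.mFourier k s
  let p : Polynomial ℂ := ∑ k ∈ c.support, Polynomial.monomial (e k) (a k)
  have hcoeff : p.coeff (e k₁) = a k₁ := by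
    simp only [p, Polynomial.finsetSum_coeff, Polynomial.coeff_monomial]
    rw [Finset.sum_eq_single_of_mem k₁ hk₁]
    · simp
    · intro k hk hkk
      rw [if_neg]
      intro h
      refine hkk (hm hk hk₁ ?_)
      have h1 := he k hk
      have h2 := he k₁ hk₁
      rw [h] at h1
      show φ k = φ k₁
      omega
  have hak : 1 ≤ ‖a k₁‖ := by
    simp only [a, norm_mul, norm_mFourier_apply, mul_one, Complex.norm_intCast]
    exact_mod_cast Int.one_le_abs (Finsupp.mem_support_iff.1 hk₁)
  have hdeg : p.natDegree = e k₁ := by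
    refine le_antisymm (Polynomial.natDegree_sum_le_of_forall_le _ _ fun k hk => ?_)
      (Polynomial.le_natDegree_of_ne_zero ?_)
    · exact (Polynomial.natDegree_monomial_le _).trans
        (Int.toNat_le_toNat (by have := hmax k hk; omega))
    · rw [hcoeff]
      exact norm_pos_iff.1 (by linarith)
  refine ⟨p, by rwa [Polynomial.leadingCoeff, hdeg, hcoeff], fun θ => ?_⟩
  set z := circleMap 0 1 θ with hz
  have hz0 : z = Complex.exp (θ * Complex.I) := by simp [hz, circleMap]
  have hnz : z ≠ 0 := by rw [hz0]; exact Complex.exp_ne_zero _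
  have hch : ∀ k, UnitAddTorus.mFourier k (torusMk ((θ / (2 * Real.pi)) • fun i => (m i : ℝ))) =
      z ^ φ k := by
    intro k
    rw [mFourier_torusMk, hz0, ← Complex.exp_int_mul]
    congr 1
    simp only [Pi.smul_apply, smul_eq_mul, hφ]
    push_cast
    have hpi : (Real.pi : ℂ) ≠ 0 := by exact_mod_cast Real.pi_ne_zero
    rw [Finset.mul_sum, Finset.sum_mul]
    refine Finset.sum_congr rfl fun i _ => ?_
    field_simp
  have hprod : F (s + torusMk ((θ / (2 * Real.pi)) • fun i => (m i : ℝ))) =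
      z ^ φ k₀ * p.eval z := by
    rw [hc, Polynomial.eval_finsetSum, Finset.mul_sum]
    refine Finset.sum_congr rfl fun k hk => ?_
    rw [mFourier_add_apply, hch, Polynomial.eval_monomial, ← zpow_natCast, he k hk]
    have : z ^ φ k = z ^ φ k₀ * z ^ (φ k - φ k₀) := by
      rw [← zpow_add₀ hnz]; congr 1; ring
    rw [this]; ring
  rw [hprod, norm_mul, norm_zpow, hz, norm_circleMap_zero]
  simp

/-- The logarithmic Mahler measure of a nonzero trigonometric polynomial with integer coefficients
is nonnegative: average over a generic one-parameter subgroup and use Jensen's formula on its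
cosets. -/
theorem integral_log_max_nonneg_of_mem_integralTrigPoly {F : UnitAddTorus (Fin r) → ℂ}
    (hF : F ∈ integralTrigPoly r) (hF0 : F ≠ 0) {ε : ℝ} (hε : 0 < ε) :
    0 ≤ ∫ s, Real.log (max ‖F s‖ ε) ∂(torusHaar r) := by
  obtain ⟨m, hm⟩ := exists_direction_of_mem_integralTrigPoly hF hF0
  set G : UnitAddTorus (Fin r) → ℝ := fun s => Real.log (max ‖F s‖ ε) with hG
  have hGc : Continuous G := by
    refine Continuous.log ?_ fun s => (lt_max_of_lt_right hε).ne'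
    have := continuous_of_mem_integralTrigPoly hF
    fun_prop
  obtain ⟨D, hD⟩ : ∃ D, ∀ s, ‖G s‖ ≤ D := by
    obtain ⟨D, hD⟩ := (isCompact_range hGc).isBounded.exists_norm_le
    exact ⟨D, fun s => hD _ ⟨s, rfl⟩⟩
  let γ : ℝ → UnitAddTorus (Fin r) := fun θ => torusMk ((θ / (2 * Real.pi)) • m)
  have hγ : Continuous γ := continuous_torusMk.comp (by fun_prop)
  have h2pi : (0 : ℝ) ≤ 2 * Real.pi := by positivity
  have h1 : ∀ s, 0 ≤ ∫ θ in Set.Ioc (0 : ℝ) (2 * Real.pi), G (s + γ θ) := by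
    intro s
    obtain ⟨p, hp, hFp⟩ := hm s
    have := integral_log_max_norm_eval_nonneg hp hε
    rw [intervalIntegral.integral_of_le h2pi] at this
    simpa only [hG, γ, hFp] using this
  have h2 : ∫ s, (∫ θ in Set.Ioc (0 : ℝ) (2 * Real.pi), G (s + γ θ)) ∂(torusHaar r) =
      2 * Real.pi * ∫ s, G s ∂(torusHaar r) := by
    rw [integral_integral_swap]
    · simp only [integral_add_right_eq_self]
      simp [h2pi]
    · refine Integrable.of_bound (C := D) ?_ (Eventually.of_forall fun z => hD _)
      refine Continuous.aestronglyMeasurable ?_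
      show Continuous fun z : UnitAddTorus (Fin r) × ℝ => G (z.1 + γ z.2)
      fun_prop
  have h3 : 0 ≤ ∫ s, (∫ θ in Set.Ioc (0 : ℝ) (2 * Real.pi), G (s + γ θ)) ∂(torusHaar r) :=
    integral_nonneg fun s => h1 s
  rw [h2] at h3
  exact nonneg_of_mul_nonneg_right h3 (by positivity)

end Mahler

/-! ### Ergodicity of toral endomorphisms -/

section Ergodic

variable {r : ℕ}

/-- A nonzero frequency has an infinite orbit under a nonsingular matrix without nonzero periodic
vectors. -/
theorem injective_iterate_mulVec {B : Matrix (Fin r) (Fin r) ℤ} (hdet : B.det ≠ 0)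
    (hfix : ∀ m : ℕ, 1 ≤ m → ∀ k : Fin r → ℤ, k ≠ 0 → (B ^ m).mulVec k ≠ k)
    {k : Fin r → ℤ} (hk : k ≠ 0) : Function.Injective fun j : ℕ => (B ^ j).mulVec k := by
  have hinj : ∀ j : ℕ, Function.Injective (B ^ j).mulVec := by
    intro j x y hxy
    have h0 : (B ^ j).mulVec (x - y) = 0 := by rw [Matrix.mulVec_sub, sub_eq_zero]; exact hxy
    exact sub_eq_zero.1 (Matrix.eq_zero_of_mulVec_eq_zero
      (by rw [Matrix.det_pow]; exact pow_ne_zero _ hdet) h0)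
  refine Function.Injective.of_lt_imp_ne fun i j hij h => ?_
  obtain ⟨m, rfl⟩ := Nat.exists_eq_add_of_lt hij
  have h' : (B ^ i).mulVec k = (B ^ i).mulVec ((B ^ (m + 1)).mulVec k) := by
    rw [Matrix.mulVec_mulVec, ← pow_add]
    exact h
  exact hfix (m + 1) (by omega) k hk (hinj i h').symm

/-- Parseval's identity. The volume on the torus used in `UnitAddTorus.hasSum_sq_mFourierCoeff` is
the product of normalized Haar measures, which is `torusHaar` by definition. -/
theorem hasSum_sq_norm_integral_mFourier (f : Lp ℂ 2 (torusHaar r)) :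
    HasSum (fun k => ‖∫ t, UnitAddTorus.mFourier (-k) t • f t ∂(torusHaar r)‖ ^ 2)
      (∫ t, ‖f t‖ ^ 2 ∂(torusHaar r)) :=
  UnitAddTorus.hasSum_sq_mFourierCoeff f

/-- A toral endomorphism is ergodic if the dual endomorphism has no nonzero periodic points: the
Fourier coefficients of an invariant set `A` are constant along the infinite dual orbits, hence
vanish at all nonzero frequencies, and Parseval's identity reads `μ A = (μ A) ^ 2`. -/
theorem ergodic_torusEnd {B : Matrix (Fin r) (Fin r) ℤ} (hdet : B.det ≠ 0)
    (hfix : ∀ m : ℕ, 1 ≤ m → ∀ k : Fin r → ℤ, k ≠ 0 → (B.transpose ^ m).mulVec k ≠ k) :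
    Ergodic (torusEnd B) (torusHaar r) := by
  have hmp := measurePreserving_torusEnd B hdet
  refine ⟨hmp, ⟨fun A hA hinv => ?_⟩⟩
  set f : UnitAddTorus (Fin r) → ℂ := A.indicator 1 with hf
  have hfm : Measurable f := measurable_one.indicator hA
  have hfT : ∀ s, f (torusEnd B s) = f s := by
    intro s
    have : torusEnd B s ∈ A ↔ s ∈ A := by
      conv_rhs => rw [← hinv]
      rfl
    by_cases h : s ∈ A
    · simp [hf, h, this.2 h]
    · simp [hf, h, mt this.1 h]
  have hfL : MemLp f 2 (torusHaar r) := (memLp_const (1 : ℂ)).indicator hA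
  set c : (Fin r → ℤ) → ℂ := fun k => ∫ t, UnitAddTorus.mFourier (-k) t • f t ∂(torusHaar r)
    with hc
  have hcB : ∀ k, c (B.transpose.mulVec k) = c k := by
    intro k
    have h1 : ∀ t, UnitAddTorus.mFourier (-(B.transpose.mulVec k)) t • f t =
        (fun t => UnitAddTorus.mFourier (-k) t • f t) (torusEnd B t) := by
      intro t
      simp only [mFourier_torusEnd, hfT, Matrix.mulVec_neg]
    simp only [hc, h1]
    conv_rhs => rw [← hmp.map_eq]
    rw [integral_map hmp.measurable.aemeasurable]
    exact ((UnitAddTorus.mFourier (-k)).continuous.measurable.smul hfm).aestronglyMeasurable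
  have hsum : HasSum (fun k => ‖c k‖ ^ 2) ((torusHaar r).real A) := by
    have h := hasSum_sq_norm_integral_mFourier (hfL.toLp f)
    have h1 : ∫ t, ‖hfL.toLp f t‖ ^ 2 ∂(torusHaar r) = (torusHaar r).real A := by
      rw [← integral_indicator_one hA]
      refine integral_congr_ae ?_
      filter_upwards [hfL.coeFn_toLp] with t ht
      rw [ht]
      by_cases h : t ∈ A <;> simp [hf, h]
    rw [h1] at h
    convert h using 4 with k
    refine integral_congr_ae ?_
    filter_upwards [hfL.coeFn_toLp] with t ht
    rw [ht]
  have hc0 : ∀ k, k ≠ 0 → c k = 0 := by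
    intro k hk
    have hiter : ∀ j : ℕ, c ((B.transpose ^ j).mulVec k) = c k := by
      intro j
      induction j with
      | zero => simp
      | succ j ih => rw [pow_succ', ← Matrix.mulVec_mulVec, hcB, ih]
    have h1 := hsum.summable.comp_injective
      (injective_iterate_mulVec (by rwa [Matrix.det_transpose]) hfix hk)
    -- a summable constant family vanishes
    have h2 := h1.tendsto_atTop_zero
    simp only [Function.comp_def, hiter] at h2
    have := tendsto_nhds_unique h2 tendsto_const_nhds
    simpa using this.symm
  have hcz : c 0 = (torusHaar r).real A := by
    simp only [hc, neg_zero, UnitAddTorus.mFourier_zero, ContinuousMap.one_apply, one_smul, hf]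
    rw [integral_indicator hA]
    simp
  have hsq : (torusHaar r).real A = (torusHaar r).real A ^ 2 := by
    have h := hasSum_single (f := fun k => ‖c k‖ ^ 2) 0 fun k hk => by simp [hc0 k hk]
    have := hsum.unique h
    rw [hcz, Complex.norm_real, Real.norm_eq_abs, sq_abs] at this
    exact this
  rw [Filter.eventuallyConst_set']
  have : (torusHaar r).real A = 0 ∨ (torusHaar r).real A = 1 := by
    have : (torusHaar r).real A * ((torusHaar r).real A - 1) = 0 := by linarith
    rcases mul_eq_zero.1 this with h | h
    · exact Or.inl h
    · exact Or.inr (by linarith)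
  rcases this with h | h
  · left
    rw [measureReal_eq_zero_iff] at h
    exact ae_eq_empty.2 h
  · right
    have h' : torusHaar r A = 1 := by
      rw [← ofReal_measureReal, h, ENNReal.ofReal_one]
    exact eventuallyEq_univ.2 ((prob_compl_eq_zero_iff hA).2 h')

/-- A power of an integer matrix without root-of-unity eigenvalues has no nonzero fixed vectors. -/
theorem pow_mulVec_ne_of_charpoly {B : Matrix (Fin r) (Fin r) ℤ}
    (hB : ∀ z : ℂ, (B.map (fun m : ℤ => (m : ℂ))).charpoly.IsRoot z → ∀ m : ℕ, 1 ≤ m → z ^ m ≠ 1)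
    {m : ℕ} (hm : 1 ≤ m) {k : Fin r → ℤ} (hk : k ≠ 0) : (B ^ m).mulVec k ≠ k := by
  intro h
  set A : Matrix (Fin r) (Fin r) ℂ := B.map (fun m : ℤ => (m : ℂ)) with hA
  have hAm : A ^ m = (B ^ m).map (fun m : ℤ => (m : ℂ)) :=
    (map_pow (Int.castRingHom ℂ).mapMatrix B m).symm
  have h1 : (1 : ℂ) ∈ spectrum ℂ (A ^ m) := by
    rw [spectrum.mem_iff, map_one, Matrix.isUnit_iff_isUnit_det, isUnit_iff_ne_zero, not_not]
    refine Matrix.exists_mulVec_eq_zero_iff.1 ⟨fun i => (k i : ℂ), ?_, ?_⟩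
    · intro h0
      exact hk (funext fun i => by simpa using congrFun h0 i)
    · rw [Matrix.sub_mulVec, Matrix.one_mulVec, sub_eq_zero, hAm]
      funext i
      have := congrArg (fun m : ℤ => (m : ℂ)) (congrFun h i)
      simp only [Matrix.mulVec, dotProduct, Matrix.map_apply] at this ⊢
      rw [← this]; push_cast; rfl
  rw [spectrum.map_pow_of_pos A (by omega)] at h1
  obtain ⟨z, hz, hzm⟩ := h1
  exact hB z (Matrix.mem_spectrum_iff_isRoot_charpoly.1 hz) m hm hzm

end Ergodic

/-! ### Matrix cocycles over toral endomorphisms -/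

section Cocycle

theorem cocycle_semiconj {X Y : Type*} {d : ℕ} (M : X → Matrix (Fin d) (Fin d) ℂ) {φ : Y → X}
    {S : Y → Y} {T : X → X} (h : Function.Semiconj φ S T) (n : ℕ) (y : Y) :
    cocycle (fun y => M (φ y)) S n y = cocycle M T n (φ y) := by
  induction n with
  | zero => rfl
  | succ n ih => rw [cocycle, cocycle, ih, (h.iterate_right n).eq]

theorem cocycle_add {X : Type*} {d : ℕ} (M : X → Matrix (Fin d) (Fin d) ℂ) (T : X → X)
    (m n : ℕ) (x : X) :
    cocycle M T (m + n) x = cocycle M T n (T^[m] x) * cocycle M T m x := by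
  induction n with
  | zero => simp [cocycle]
  | succ n ih =>
    rw [← add_assoc, cocycle, cocycle, ih, ← Function.iterate_add_apply, add_comm n m,
      Matrix.mul_assoc]

variable {r d : ℕ}

theorem cocycle_mem_integralTrigPoly {M : UnitAddTorus (Fin r) → Matrix (Fin d) (Fin d) ℂ}
    (hM : ∀ i j, (fun s => M s i j) ∈ integralTrigPoly r) (B : Matrix (Fin r) (Fin r) ℤ)
    (n : ℕ) (i j : Fin d) : (fun s => cocycle M (torusEnd B) n s i j) ∈ integralTrigPoly r := by
  have hiter : ∀ n : ℕ, ∀ F ∈ integralTrigPoly r,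
      (fun s => F ((torusEnd B)^[n] s)) ∈ integralTrigPoly r := by
    intro n
    induction n with
    | zero => exact fun F hF => hF
    | succ n ih =>
      intro F hF
      simp only [Function.iterate_succ_apply']
      exact ih _ (comp_torusEnd_mem_integralTrigPoly B hF)
  induction n generalizing i with
  | zero =>
    by_cases h : i = j
    · simp only [cocycle, Matrix.one_apply, h, if_true]
      exact Subring.one_mem _
    · simp only [cocycle, Matrix.one_apply, h, if_false]
      exact Subring.zero_mem _
  | succ n ih =>
    have : (fun s => cocycle M (torusEnd B) (n + 1) s i j) =
        ∑ l, (fun s => M ((torusEnd B)^[n] s) i l) * fun s => cocycle M (torusEnd B) n s l j := by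
      funext s
      simp [cocycle, Matrix.mul_apply, Finset.sum_apply]
    rw [this]
    exact Subring.sum_mem _ fun l _ => Subring.mul_mem _ (hiter n _ (hM i l)) (ih l)

attribute [local instance] Matrix.frobeniusNormedAddCommGroup

theorem norm_entry_le_frobenius_norm (A : Matrix (Fin d) (Fin d) ℂ) (i j : Fin d) :
    ‖A i j‖ ≤ ‖A‖ := by
  rw [Matrix.frobenius_norm_def, ← Real.sqrt_eq_rpow]
  refine Real.le_sqrt_of_sq_le ?_
  simp only [Real.rpow_two]
  calc ‖A i j‖ ^ 2 ≤ ∑ j, ‖A i j‖ ^ 2 :=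
        Finset.single_le_sum (f := fun j => ‖A i j‖ ^ 2) (fun _ _ => sq_nonneg _)
          (Finset.mem_univ j)
    _ ≤ _ := Finset.single_le_sum (f := fun i => ∑ j, ‖A i j‖ ^ 2)
        (fun _ _ => Finset.sum_nonneg fun _ _ => sq_nonneg _) (Finset.mem_univ i)

theorem continuous_frobenius_norm {X : Type*} [TopologicalSpace X]
    {A : X → Matrix (Fin d) (Fin d) ℂ} (hA : ∀ i j, Continuous fun x => A x i j) :
    Continuous fun x => ‖A x‖ := by
  simp only [Matrix.frobenius_norm_def, ← Real.sqrt_eq_rpow, Real.rpow_two]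
  fun_prop

/-- The logarithm of the norm of the cocycle, floored at `-n`. The floor makes it a bounded
continuous function and keeps the sequence subadditive; as the exponential growth rate turns out to
be nonnegative, it does not affect the asymptotics. -/
noncomputable def flooredLog {X : Type*} (M : X → Matrix (Fin d) (Fin d) ℂ) (T : X → X) (n : ℕ)
    (x : X) : ℝ :=
  Real.log (max ‖cocycle M T n x‖ (Real.exp (-n)))

theorem neg_le_flooredLog {X : Type*} (M : X → Matrix (Fin d) (Fin d) ℂ) (T : X → X) (n : ℕ)
    (x : X) : -(n : ℝ) ≤ flooredLog M T n x := by
  rw [flooredLog, Real.le_log_iff_exp_le (lt_max_of_lt_right (Real.exp_pos _))]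
  exact le_max_right _ _

theorem flooredLog_add_le {X : Type*} (M : X → Matrix (Fin d) (Fin d) ℂ) (T : X → X)
    (m n : ℕ) (x : X) :
    flooredLog M T (m + n) x ≤ flooredLog M T m x + flooredLog M T n (T^[m] x) := by
  have h : ∀ n x, 0 < max ‖cocycle M T n x‖ (Real.exp (-n)) := fun n x =>
    lt_max_of_lt_right (Real.exp_pos _)
  rw [flooredLog, flooredLog, flooredLog, ← Real.log_mul (h _ _).ne' (h _ _).ne']
  refine Real.log_le_log (h _ _) (max_le ?_ ?_)
  · rw [cocycle_add, mul_comm (max _ _)]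
    refine (Matrix.frobenius_norm_mul _ _).trans ?_
    gcongr
    · exact le_max_left _ _
    · exact le_max_left _ _
  · rw [show -((m + n : ℕ) : ℝ) = -m + -n by push_cast; ring, Real.exp_add]
    gcongr
    · exact le_max_right _ _
    · exact le_max_right _ _

theorem logNorm_cocycle_div_le {X : Type*} (M : X → Matrix (Fin d) (Fin d) ℂ) (T : X → X) (n : ℕ)
    (x : X) : logNorm (cocycle M T n x) / (n : EReal) ≤ ((flooredLog M T n x / n : ℝ) : EReal) := by
  rw [EReal.coe_div, EReal.coe_natCast]
  refine EReal.div_le_div_right_of_nonneg (by positivity) ?_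
  have h : 0 < max ‖cocycle M T n x‖ (Real.exp (-n)) := lt_max_of_lt_right (Real.exp_pos _)
  rw [flooredLog, ← ENNReal.log_ofReal_of_pos h, logNorm, ← ofReal_norm]
  exact ENNReal.log_monotone (ENNReal.ofReal_le_ofReal (le_max_left _ _))

theorem logNorm_cocycle_div_eq {X : Type*} {M : X → Matrix (Fin d) (Fin d) ℂ} {T : X → X} {n : ℕ}
    {x : X} (h : -(n : ℝ) < flooredLog M T n x) :
    logNorm (cocycle M T n x) / (n : EReal) = ((flooredLog M T n x / n : ℝ) : EReal) := by
  have h0 : 0 < max ‖cocycle M T n x‖ (Real.exp (-n)) := lt_max_of_lt_right (Real.exp_pos _)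
  rw [flooredLog, Real.lt_log_iff_exp_lt h0, lt_max_iff, lt_self_iff_false, or_false] at h
  rw [EReal.coe_div, EReal.coe_natCast, flooredLog, max_eq_left h.le,
    ← ENNReal.log_ofReal_of_pos ((Real.exp_pos _).trans h), logNorm, ← ofReal_norm]

variable {M : UnitAddTorus (Fin r) → Matrix (Fin d) (Fin d) ℂ}

theorem continuous_flooredLog (hM : ∀ i j, (fun s => M s i j) ∈ integralTrigPoly r)
    (B : Matrix (Fin r) (Fin r) ℤ) (n : ℕ) : Continuous (flooredLog M (torusEnd B) n) := by
  refine Continuous.log ?_ fun s => (lt_max_of_lt_right (Real.exp_pos _)).ne'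
  exact (continuous_frobenius_norm fun i j => continuous_of_mem_integralTrigPoly
    (cocycle_mem_integralTrigPoly hM B n i j)).max continuous_const

theorem exists_abs_flooredLog_le (hM : ∀ i j, (fun s => M s i j) ∈ integralTrigPoly r)
    (B : Matrix (Fin r) (Fin r) ℤ) :
    ∃ C : ℝ, ∀ n s, |flooredLog M (torusEnd B) n s| ≤ C * (n + 1) := by
  have hb : ∀ n, ∃ D, ∀ s, ‖flooredLog M (torusEnd B) n s‖ ≤ D := by
    intro n
    obtain ⟨D, hD⟩ := (isCompact_range (continuous_flooredLog hM B n)).isBounded.exists_norm_le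
    exact ⟨D, fun s => hD _ ⟨s, rfl⟩⟩
  obtain ⟨D₀, h₀⟩ := hb 0
  obtain ⟨D₁, h₁⟩ := hb 1
  set C := max 1 (max D₀ D₁)
  have hC0 : D₀ ≤ C := (le_max_left _ _).trans (le_max_right _ _)
  have hC1 : D₁ ≤ C := (le_max_right _ _).trans (le_max_right _ _)
  have hC : 1 ≤ C := le_max_left _ _
  refine ⟨C, fun n s => abs_le.2 ⟨?_, ?_⟩⟩
  · have := neg_le_flooredLog M (torusEnd B) n s
    have hn : (0 : ℝ) ≤ n := n.cast_nonneg
    nlinarith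
  · induction n with
    | zero => simpa using ((le_abs_self _).trans (h₀ s)).trans hC0
    | succ n ih =>
      have h2 := flooredLog_add_le M (torusEnd B) n 1 s
      have h3 := (le_abs_self _).trans (h₁ ((torusEnd B)^[n] s))
      push_cast
      linarith

theorem integral_flooredLog_nonneg (hM : ∀ i j, (fun s => M s i j) ∈ integralTrigPoly r)
    (B : Matrix (Fin r) (Fin r) ℤ) {n : ℕ} {s₀ : UnitAddTorus (Fin r)}
    (hs₀ : cocycle M (torusEnd B) n s₀ ≠ 0) :
    0 ≤ ∫ s, flooredLog M (torusEnd B) n s ∂(torusHaar r) := by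
  obtain ⟨i, j, hij⟩ : ∃ i j, cocycle M (torusEnd B) n s₀ i j ≠ 0 := by
    by_contra! h
    exact hs₀ (Matrix.ext h)
  have hF := cocycle_mem_integralTrigPoly hM B n i j
  refine (integral_log_max_nonneg_of_mem_integralTrigPoly hF (fun h => hij (congrFun h s₀))
    (Real.exp_pos (-n))).trans (integral_mono ?_ ?_ fun s => ?_)
  · refine Continuous.integrable_of_hasCompactSupport ?_ (HasCompactSupport.of_compactSpace _)
    refine Continuous.log ?_ fun s => (lt_max_of_lt_right (Real.exp_pos _)).ne'
    exact (continuous_of_mem_integralTrigPoly hF).norm.max continuous_const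
  · exact (continuous_flooredLog hM B n).integrable_of_hasCompactSupport
      (HasCompactSupport.of_compactSpace _)
  · exact Real.log_le_log (lt_max_of_lt_right (Real.exp_pos _))
      (max_le_max_right _ (norm_entry_le_frobenius_norm _ i j))

/-- The Furstenberg–Kesten theorem for a cocycle of integral trigonometric polynomials over an
ergodic toral endomorphism, with a real exponent, which also bounds the upper exponent at every
point whose orbit is uniformly distributed. -/
theorem exists_lyapunovExponent (hM : ∀ i j, (fun s => M s i j) ∈ integralTrigPoly r)
    {B : Matrix (Fin r) (Fin r) ℤ} (hB : Ergodic (torusEnd B) (torusHaar r))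
    (hne : ∀ n, ∃ s, cocycle M (torusEnd B) n s ≠ 0) :
    ∃ χ : ℝ,
      (∀ᵐ s ∂(torusHaar r), Tendsto
        (fun n : ℕ => logNorm (cocycle M (torusEnd B) n s) / (n : EReal)) atTop (𝓝 (χ : EReal))) ∧
      ∀ x : ℕ → Fin r → ℝ, UDModOne x →
        (∀ n, torusMk (x n) = (torusEnd B)^[n] (torusMk (x 0))) →
        limsup (fun n : ℕ => logNorm (cocycle M (torusEnd B) n (torusMk (x 0))) / (n : EReal))
          atTop ≤ χ := by
  obtain ⟨C, hC⟩ := exists_abs_flooredLog_le hM B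
  have hcont := continuous_flooredLog hM B
  have hmeas : ∀ n, Measurable (flooredLog M (torusEnd B) n) := fun n => (hcont n).measurable
  have hsub := flooredLog_add_le M (torusEnd B)
  set hs := subadditive_integral hB.toMeasurePreserving hmeas hC hsub
  have hγ0 : 0 ≤ hs.lim := by
    refine ge_of_tendsto' (hs.tendsto_lim (bddBelow_integral_div hC)) fun n => ?_
    obtain ⟨s, h⟩ := hne n
    exact div_nonneg (integral_flooredLog_nonneg hM B h) n.cast_nonneg
  refine ⟨hs.lim, ?_, fun x hx horb => ?_⟩
  · have hbirk : ∀ᵐ s ∂(torusHaar r), ∀ k, ∀ q > ∫ s, flooredLog M (torusEnd B) k s ∂(torusHaar r),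
        ∀ᶠ n : ℕ in atTop,
          ∑ j ∈ Finset.range n, flooredLog M (torusEnd B) k ((torusEnd B)^[j] s) ≤ q * n :=
      ae_all_iff.2 fun k => ae_eventually_sum_le_of_ergodic hB (hmeas k) (hC k)
    filter_upwards [hbirk, ae_forall_eventually_lt_of_subadditive hB hmeas hC hsub] with s h1 h2
    have hlim : Tendsto (fun n : ℕ => flooredLog M (torusEnd B) n s / n) atTop (𝓝 hs.lim) := by
      refine tendsto_order.2 ⟨fun a ha => ?_, fun a ha => ?_⟩
      · obtain ⟨b, hab, hb⟩ := exists_between ha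
        filter_upwards [h2 b hb, eventually_gt_atTop 0] with n hn hn0
        have : (0 : ℝ) < n := by exact_mod_cast hn0
        exact hab.trans_le ((le_div_iff₀ this).2 hn)
      · obtain ⟨b, hb, hba⟩ := exists_between ha
        filter_upwards [eventually_le_of_forall_sum_le hB.toMeasurePreserving hmeas hC hsub s h1 hb,
          eventually_gt_atTop 0] with n hn hn0
        have : (0 : ℝ) < n := by exact_mod_cast hn0
        exact ((div_le_iff₀ this).2 hn).trans_lt hba
    refine ((continuous_coe_real_ereal.tendsto _).comp hlim).congr' ?_
    filter_upwards [h2 (-1 / 2) (by linarith), eventually_gt_atTop 0] with n hn hn0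
    have : (0 : ℝ) < n := by exact_mod_cast hn0
    exact (logNorm_cocycle_div_eq (by linarith)).symm
  · have h1 : ∀ k, ∀ q > ∫ s, flooredLog M (torusEnd B) k s ∂(torusHaar r), ∀ᶠ n : ℕ in atTop,
        ∑ j ∈ Finset.range n, flooredLog M (torusEnd B) k ((torusEnd B)^[j] (torusMk (x 0))) ≤
          q * n := by
      intro k q hq
      simp only [← horb]
      exact hx.eventually_sum_le (hcont k) hq
    refine EReal.le_of_forall_lt_iff_le.1 fun z hz => ?_
    refine limsup_le_of_le (by isBoundedDefault) ?_
    filter_upwards [eventually_le_of_forall_sum_le hB.toMeasurePreserving hmeas hC hsub _ h1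
      (EReal.coe_lt_coe_iff.1 hz), eventually_gt_atTop 0] with n hn hn0
    have : (0 : ℝ) < n := by exact_mod_cast hn0
    refine (logNorm_cocycle_div_le _ _ _ _).trans ?_
    exact EReal.coe_le_coe_iff.2 ((div_le_iff₀ this).2 hn)

end Cocycle

/-! ### Coordinates with respect to lattice bases -/

section Lattice

variable {d r : ℕ} {V : Submodule ℝ (Fin d → ℝ)}

theorem coe_equivFun_symm_apply (b : Module.Basis (Fin r) ℝ V) (x : Fin r → ℝ) (i : Fin d) :
    (b.equivFun.symm x : Fin d → ℝ) i = ∑ p, x p * (b p : Fin d → ℝ) i := by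
  simp [Module.Basis.equivFun_symm_apply, Finset.sum_apply]

theorem IsIntegerVector.realMap {x : Fin d → ℝ} (hx : IsIntegerVector x)
    (A : Matrix (Fin d) (Fin d) ℤ) : IsIntegerVector (realMap A x) := by
  choose m hm using hx
  refine fun i => ⟨∑ j, A i j * m j, ?_⟩
  simp [SpectralCocycle.realMap, Matrix.mulVec, dotProduct, hm]

/-- A linear map carrying the integer vectors of `V` to integer vectors has an integer matrix with
respect to lattice bases. -/
theorem IsLatticeBasis.exists_toMatrix_eq {b b' : Module.Basis (Fin r) ℝ V}
    (hb : IsLatticeBasis b) (hb' : IsLatticeBasis b') {f : V →ₗ[ℝ] V}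
    (hf : ∀ x : V, IsIntegerVector (x : Fin d → ℝ) → IsIntegerVector (f x : Fin d → ℝ)) :
    ∃ B : Matrix (Fin r) (Fin r) ℤ, LinearMap.toMatrix b' b f = B.map (fun m : ℤ => (m : ℝ)) := by
  choose B hB using fun i j => hb.2 (f (b' j)) (hf _ (hb'.1 j)) i
  refine ⟨Matrix.of B, Matrix.ext fun i j => ?_⟩
  rw [LinearMap.toMatrix_apply]
  exact hB i j

/-- The coordinate sums occurring in the exponents of the spectral matrix are integer linear forms
in the coordinates with respect to a lattice basis. -/
theorem IsLatticeBasis.exists_sum_map_eq {b : Module.Basis (Fin r) ℝ V} (hb : IsLatticeBasis b)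
    (L : List (Fin d)) :
    ∃ k : Fin r → ℤ, ∀ x : Fin r → ℝ,
      (L.map (b.equivFun.symm x : Fin d → ℝ)).sum = ∑ p, (k p : ℝ) * x p := by
  choose m hm using hb.1
  induction L with
  | nil => exact ⟨0, fun x => by simp⟩
  | cons a L ih =>
    obtain ⟨k, hk⟩ := ih
    refine ⟨fun p => m p a + k p, fun x => ?_⟩
    rw [List.map_cons, List.sum_cons, hk, coe_equivFun_symm_apply, ← Finset.sum_add_distrib]
    refine Finset.sum_congr rfl fun p _ => ?_
    rw [hm]; push_cast; ring

theorem IsLatticeBasis.exists_spectralMatrix_eq {b : Module.Basis (Fin r) ℝ V}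
    (hb : IsLatticeBasis b) (ζ : Substitution d) (i j : Fin d) :
    ∃ F ∈ integralTrigPoly r, ∀ x : Fin r → ℝ,
      ζ.spectralMatrix (b.equivFun.symm x : Fin d → ℝ) i j = F (torusMk x) := by
  choose k hk using fun l : Fin (ζ.word i).length => hb.exists_sum_map_eq ((ζ.word i).take l)
  refine ⟨∑ l, if (ζ.word i).get l = j then ⇑(UnitAddTorus.mFourier (-k l)) else 0,
    Subring.sum_mem _ fun l _ => ?_, fun x => ?_⟩
  · split_ifs
    · exact mFourier_mem_integralTrigPoly _
    · exact Subring.zero_mem _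
  · rw [Substitution.spectralMatrix, Matrix.of_apply, Finset.sum_apply]
    refine Finset.sum_congr rfl fun l _ => ?_
    split_ifs
    · rw [mFourier_torusMk, hk]
      congr 1
      simp only [Pi.neg_apply]
      push_cast
      simp only [neg_mul, Finset.sum_neg_distrib, mul_neg]
    · rfl

end Lattice

/-! ### The spectral cocycle -/

section Substitution

variable {d r : ℕ}

/-- At the origin the spectral matrix is a nonnegative integer matrix without zero rows, so none of
its powers vanish. -/
theorem Substitution.spectralCocycle_zero_ne_zero (hd : 0 < d) (ζ : Substitution d) (n : ℕ) :
    ζ.spectralCocycle n 0 ≠ 0 := by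
  have hiter : ∀ n : ℕ, (realMap ζ.matrix.transpose)^[n] 0 = 0 := fun n =>
    Function.iterate_fixed (map_zero _) n
  have key : ∃ u : Fin d → ℕ, (∀ i, 1 ≤ u i) ∧
      (ζ.spectralCocycle n 0).mulVec 1 = fun i => (u i : ℂ) := by
    unfold Substitution.spectralCocycle
    induction n with
    | zero => exact ⟨1, fun i => le_rfl, by simp [cocycle]; rfl⟩
    | succ n ih =>
      obtain ⟨u, hu, h⟩ := ih
      refine ⟨fun i => ∑ l : Fin (ζ.word i).length, u ((ζ.word i).get l), fun i => ?_, ?_⟩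
      · have hl : 0 < (ζ.word i).length := List.length_pos_iff.2 (ζ.word_ne_nil i)
        exact (hu _).trans (Finset.single_le_sum (f := fun l => u ((ζ.word i).get l))
          (fun _ _ => Nat.zero_le _) (Finset.mem_univ (⟨0, hl⟩ : Fin (ζ.word i).length)))
      · rw [cocycle, ← Matrix.mulVec_mulVec, h, hiter]
        funext i
        have h0 : ∀ L : List (Fin d), (L.map (0 : Fin d → ℝ)).sum = 0 := by
          intro L; induction L <;> simp_all
        simp only [Matrix.mulVec, dotProduct, Substitution.spectralMatrix, Matrix.of_apply, h0,
          Complex.ofReal_zero, mul_zero, Complex.exp_zero, Finset.sum_mul]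
        rw [Finset.sum_comm]
        push_cast
        refine Finset.sum_congr rfl fun l _ => ?_
        simp
  obtain ⟨u, hu, h⟩ := key
  intro h0
  have := congrFun h ⟨0, hd⟩
  rw [h0, Matrix.zero_mulVec, Pi.zero_apply] at this
  have h1 := hu ⟨0, hd⟩
  have h2 : u ⟨0, hd⟩ = 0 := by exact_mod_cast this.symm
  omega

/-- In any basis `b`, the essential cocycle is the spectral cocycle read in the coordinates of
`b`. -/
theorem Substitution.essentialCocycle_eq_spectralCocycle (ζ : Substitution d) (v : Fin d → ℝ)
    (b : Module.Basis (Fin r) ℝ (ζ.minSubspace v)) (n : ℕ) (x : Fin r → ℝ) :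
    ζ.essentialCocycle v b n x = ζ.spectralCocycle n (b.equivFun.symm x : Fin d → ℝ) := by
  refine cocycle_semiconj ζ.spectralMatrix
    (φ := fun x => (b.equivFun.symm x : Fin d → ℝ)) (fun x => ?_) n x
  have h := LinearMap.toMatrix_mulVec_repr b b (restrictedMap ζ.matrix.transpose v)
    (b.equivFun.symm x)
  have h1 : ⇑(b.repr (b.equivFun.symm x)) = x := b.equivFun.apply_symm_apply x
  rw [h1] at h
  show ((b.equivFun.symm ((LinearMap.toMatrix b b _).mulVec x) : ζ.minSubspace v) : Fin d → ℝ) = _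
  rw [h]
  have h2 := b.equivFun.symm_apply_apply
    (restrictedMap ζ.matrix.transpose v (b.equivFun.symm x))
  rw [Module.Basis.equivFun_apply] at h2
  rw [h2]
  rfl

end Substitution

end SpectralCocycle

theorem proposition4p3 {d : ℕ} (hd : 2 ≤ d) (ζ : Substitution d)
    (v : Fin d → ℝ) (hv : v ≠ 0)
    (hdet : LinearMap.det (restrictedMap ζ.matrix.transpose v) ≠ 0)
    (hroot : NoRootOfUnityEigenvalue (restrictedMap ζ.matrix.transpose v))
    (w : ζ.minSubspace v)
    (hud : ∀ k : ℕ, 1 ≤ k →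
      UDModOneIn (fun n : ℕ => (restrictedMap ζ.matrix.transpose v ^ (k * n)) w)) :
    ∃ χ : ℝ, ζ.IsEssentialLyapunovExponent v χ ∧
      ζ.upperLyapunovExponent (w : Fin d → ℝ) ≤ (χ : EReal) := by
  obtain ⟨b, hb, hbud⟩ := hud 1 le_rfl
  simp only [one_mul] at hbud
  set f := restrictedMap ζ.matrix.transpose v with hf
  obtain ⟨B, hB⟩ := hb.exists_toMatrix_eq hb (f := f) fun x hx => hx.realMap ζ.matrix.transpose
  have hBdet : B.det ≠ 0 := by
    rw [← LinearMap.det_toMatrix b, hB] at hdet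
    rw [det_map_intCast] at hdet
    exact_mod_cast hdet
  have hchar : (B.transpose.map (fun m : ℤ => (m : ℂ))).charpoly =
      f.charpoly.map (algebraMap ℝ ℂ) := by
    rw [← LinearMap.charpoly_toMatrix f b, hB, ← Matrix.charpoly_map, Matrix.transpose_map,
      Matrix.charpoly_transpose]
    congr 1
  have herg : Ergodic (torusEnd B) (torusHaar _) := by
    refine ergodic_torusEnd hBdet fun m hm k hk => pow_mulVec_ne_of_charpoly ?_ hm hk
    rw [hchar]
    exact hroot
  set M : UnitAddTorus (Fin (Module.finrank ℝ (ζ.minSubspace v))) → Matrix (Fin d) (Fin d) ℂ :=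
    fun s => ζ.spectralMatrix (b.equivFun.symm (torusRep s) : Fin d → ℝ) with hMdef
  -- by periodicity, the spectral matrix in the coordinates of `b` descends to the torus
  have hM : ∀ i j, (fun s => M s i j) ∈ integralTrigPoly _ := by
    intro i j
    obtain ⟨F, hF, h⟩ := hb.exists_spectralMatrix_eq ζ i j
    have : (fun s => M s i j) = F := funext fun s => by
      simp only [hMdef, h, torusMk_torusRep]
    rwa [this]
  have hMmk : ∀ x, M (torusMk x) = ζ.spectralMatrix (b.equivFun.symm x : Fin d → ℝ) := by
    intro x
    ext i j
    obtain ⟨F, _, h⟩ := hb.exists_spectralMatrix_eq ζ i j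
    simp only [hMdef, h, torusMk_torusRep]
  have hess : ∀ n x, ζ.essentialCocycle v b n x = cocycle M (torusEnd B) n (torusMk x) := by
    intro n x
    rw [← cocycle_semiconj M (φ := torusMk) (S := (LinearMap.toMatrix b b f).mulVec)
      (fun y => by rw [hB, torusEnd_torusMk])]
    simp only [hMmk]
    rfl
  have hspec : ∀ n (y : ζ.minSubspace v), ζ.spectralCocycle n (y : Fin d → ℝ) =
      cocycle M (torusEnd B) n (torusMk (b.equivFun y)) := by
    intro n y
    rw [← hess, ζ.essentialCocycle_eq_spectralCocycle, LinearEquiv.symm_apply_apply]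
  obtain ⟨χ, hχ, hχud⟩ := exists_lyapunovExponent hM herg fun n => by
    refine ⟨torusMk (b.equivFun 0), ?_⟩
    rw [← hspec]
    exact ζ.spectralCocycle_zero_ne_zero (by omega) n
  refine ⟨χ, ⟨⟨b, hb⟩, fun b' hb' => ?_⟩, ?_⟩
  · -- the change of lattice basis is an integer matrix `P`, which preserves Haar measure
    obtain ⟨P, hP⟩ := hb.exists_toMatrix_eq hb' (f := LinearMap.id) fun x hx => hx
    have hPdet : P.det ≠ 0 := by
      intro h
      have h1 : (P.map (fun m : ℤ => (m : ℝ))).det = 0 := by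
        rw [det_map_intCast, h, Int.cast_zero]
      have h2 := LinearMap.toMatrix_comp b b' b LinearMap.id LinearMap.id
      rw [LinearMap.id_comp, LinearMap.toMatrix_id, hP] at h2
      have h3 := congrArg Matrix.det h2
      rw [Matrix.det_one, Matrix.det_mul, h1, zero_mul] at h3
      exact one_ne_zero h3
    have hcob : ∀ n s, ζ.essentialCocycle v b' n (torusRep s) =
        cocycle M (torusEnd B) n (torusEnd P s) := by
      intro n s
      rw [ζ.essentialCocycle_eq_spectralCocycle, hspec]
      congr 1
      conv_rhs => rw [← torusMk_torusRep s, torusEnd_torusMk, ← hP]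
      have h := LinearMap.toMatrix_mulVec_repr b' b LinearMap.id (b'.equivFun.symm (torusRep s))
      have h1 : ⇑(b'.repr (b'.equivFun.symm (torusRep s))) = torusRep s :=
        b'.equivFun.apply_symm_apply _
      rw [h1] at h
      rw [h]
      rfl
    filter_upwards [(measurePreserving_torusEnd P hPdet).quasiMeasurePreserving.ae hχ] with s hs
    simpa only [hcob] using hs
  · have horb : ∀ n, torusMk (b.equivFun ((f ^ n) w)) =
        (torusEnd B)^[n] (torusMk (b.equivFun ((f ^ 0) w))) := by
      intro n
      induction n with
      | zero => rfl
      | succ n ih =>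
        rw [Function.iterate_succ_apply', ← ih, torusEnd_torusMk, ← hB, pow_succ',
          Module.End.mul_apply]
        congr 1
        exact (LinearMap.toMatrix_mulVec_repr b b f _).symm
    have := hχud _ hbud horb
    rw [Substitution.upperLyapunovExponent]
    simp only [hspec]
    simpa using this
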